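/- Let $n\ge 3$ and let $L_1,\dots,L_n:\mathbb R^2\to\mathbb R$ be surjective linear maps that are nondegenerate: for any two indices $i\ne j$ the map $x\mapsto (L_i(x),L_j(x))$ is a bijection of $\mathbb R^2$ onto $\mathbb R^2$. Write $|E|$ for the Lebesgue measure of $E$. For a Lebesgue measurable set $E\subset\mathbb R$ with $|E|<\infty$ let $E^*=[-|E|/2,\,|E|/2]$, and put $$I(E_1,\dots,E_n)=\int_{\mathbb R^2}\prod_{j=1}^n \mathbf 1_{E_j}(L_j(x))\,dx .$$ Let $(E_1,\dots,E_n)$ be an $n$-tuple of subsets of $\mathbb R$ that is admissible relative to $(L_j)$: each $E_j$ is Lebesgue measurable with $0<|E_j|<\infty$, and, with $S_j^\star=\{x\in\mathbb R^2: L_j(x)\in E_j^*\}$, there is no index $k$ such that $S_k^\star$ contains an open neighborhood of $\bigcap_{j\ne k}S_j^\star$. If $I(E_1,\dots,E_n)=I(E_1^*,\dots,E_n^*)$, then there exist a point $z\in\mathbb R^2$ and, for each index $i$, an interval $J_i\subset\mathbb R$ such that $|E_i\,\triangle\, J_i|=0$ and the center point of $J_i$ equals $L_i(z)$. Conversely,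 whenever such $z$ and $J_1,\dots,J_n$ exist, $I(E_1,\dots,E_n)=I(E_1^*,\dots,E_n^*)$. -/

import Mathlib

open MeasureTheory Set
open scoped ENNReal

/-- A family of linear maps `L j : ℝᵐ → ℝ` is nondegenerate if for every set `S` of `m` indices
the map `x ↦ (L j x : j ∈ S)` from `ℝᵐ` to `ℝ^S` is a bijection. -/
def Nondegenerate {m n : ℕ} (L : Fin n → ((Fin m → ℝ) →ₗ[ℝ] ℝ)) : Prop :=
  ∀ S : Finset (Fin n), S.card = m →
    Function.Bijective (fun (x : Fin m → ℝ) (j : S) => L j x)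

/-- The rearrangement `E*`: the closed interval centered at `0` with the (finite) Lebesgue measure
of `E`. -/
noncomputable def symmInterval (E : Set ℝ) : Set ℝ :=
  Icc (-((volume E).toReal / 2)) ((volume E).toReal / 2)

/-- `I(E_1, …, E_n) = ∫_{ℝᵐ} ∏ j, 1_{E_j}(L_j x) dx`, with values in `[0, ∞]`. -/
noncomputable def multiForm {m n : ℕ} (L : Fin n → ((Fin m → ℝ) →ₗ[ℝ] ℝ))
    (E : Fin n → Set ℝ) : ℝ≥0∞ :=
  ∫⁻ x : Fin m → ℝ, ∏ j, (E j).indicator (fun _ => (1 : ℝ≥0∞)) (L j x)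

/-- The closed strip `{x : L x ∈ E*}`. -/
def starStrip {m : ℕ} (L : (Fin m → ℝ) →ₗ[ℝ] ℝ) (E : Set ℝ) : Set (Fin m → ℝ) :=
  {x | L x ∈ symmInterval E}

/-- Admissibility: every `E j` is Lebesgue measurable with positive finite measure, and for no
index `k` does the strip of `k` contain an open neighborhood of the intersection of the other
strips. -/
def Admissible {m n : ℕ} (L : Fin n → ((Fin m → ℝ) →ₗ[ℝ] ℝ)) (E : Fin n → Set ℝ) : Prop :=
  (∀ j, NullMeasurableSet (E j) volume ∧ 0 < volume (E j) ∧ volume (E j) < ∞) ∧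
  ¬ ∃ k, ∃ U : Set (Fin m → ℝ), IsOpen U ∧
      (⋂ j ∈ {j : Fin n | j ≠ k}, starStrip (L j) (E j)) ⊆ U ∧ U ⊆ starStrip (L k) (E k)

/-- `J` is a bounded nonempty interval of `ℝ` (with or without its endpoints) whose center point
is `c`. In `ℝ`, a set with a greatest lower bound is nonempty. -/
def IsIntervalCenteredAt (J : Set ℝ) (c : ℝ) : Prop :=
  J.OrdConnected ∧ ∃ a b : ℝ, IsGLB J a ∧ IsLUB J b ∧ c = (a + b) / 2

/-! Both the rearrangement inequality and its equality cases follow by induction on the number of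
strips. If a strip is redundant (it contains the intersection of the others), dropping it leaves the
polygon of centered strips unchanged and can only enlarge the set cut out by the `E j`, so fewer
strips suffice. Two strips give a product in suitable coordinates, where equality always holds.

If no strip is redundant, fix `n`, let `v` span the kernel of `L n`, and cut mass `η * |L j v|` off
both ends of each `E j`, `j ≠ n`. Along every line parallel to `v` each cut has length `η`, so a
slice loses at most `2 * η`; for the centered strips it loses at least that much, as long as each
slice of the smaller polygon is nonempty. Hence the inequality for the truncated sets implies the
original one. The parameter `η` is the greatest one for which every strip still touches the polygon;
there some strip is redundant (`exists_truncated`).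

Admissibility says exactly what is needed for equality: every strip touches the polygon. If a
touching strip `k` is redundant, equality survives its removal, and almost every point satisfying
the other conditions satisfies `L k x ∈ E k`. The remaining sets are intervals with a common center
by induction, or, when two remain, by equality in Brunn–Minkowski on the line; the inclusion then
determines `E k`. If no strip is redundant, equality passes to the truncated sets. As `E n` itself
is untouched it is an interval; letting `n` vary, all the sets are intervals. Symmetric truncation
of an interval keeps its center, so the centers for one truncation serve the original sets. -/

/-- Coordinates dual to a pair of independent linear forms on the plane, with Fubini's theorem for
slices along the kernel of the second form. -/
theorem exists_dual_slicing (f g : (Fin 2 → ℝ) →ₗ[ℝ] ℝ)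
    (h : Function.Bijective fun x => (f x, g x)) :
    ∃ (v u : Fin 2 → ℝ) (C : ℝ≥0∞), f v = 1 ∧ g v = 0 ∧ f u = 0 ∧ g u = 1 ∧
      (∀ x, x = f x • v + g x • u) ∧ C ≠ 0 ∧ C ≠ ∞ ∧
      Measure.QuasiMeasurePreserving (fun p : ℝ × ℝ => p.1 • v + p.2 • u) ∧
      ∀ S : Set (Fin 2 → ℝ), MeasurableSet S →
        volume S = C * ∫⁻ t : ℝ, volume {r : ℝ | r • v + t • u ∈ S} := by
  let e : (Fin 2 → ℝ) ≃ₗ[ℝ] ℝ × ℝ := LinearEquiv.ofBijective (f.prod g) h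
  have he : ∀ x, e x = (f x, g x) := fun x => rfl
  let Φ : (ℝ × ℝ) ≃L[ℝ] (Fin 2 → ℝ) := e.symm.toContinuousLinearEquiv
  have hΦ : ∀ p, e (Φ p) = p := fun p => e.apply_symm_apply p
  have hf : ∀ p, f (Φ p) = p.1 := fun p => congrArg Prod.fst (hΦ p)
  have hg : ∀ p, g (Φ p) = p.2 := fun p => congrArg Prod.snd (hΦ p)
  have hΦrt : ∀ r t : ℝ, Φ (r, t) = r • Φ (1, 0) + t • Φ (0, 1) := by
    intro r t
    rw [← map_smul, ← map_smul, ← map_add]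
    simp
  obtain ⟨C, hC0, hC⟩ : ∃ C : NNReal, C ≠ 0 ∧
      (volume : Measure (Fin 2 → ℝ)) = C • (volume : Measure (ℝ × ℝ)).map Φ := by
    refine ⟨_, ?_, Measure.isAddLeftInvariant_eq_smul _ _⟩
    exact (Measure.addHaarScalarFactor_pos_of_isAddHaarMeasure _ _).ne'
  refine ⟨Φ (1, 0), Φ (0, 1), C, hf _, hg _, hf _, hg _, ?_, by simpa using hC0,
    ENNReal.coe_ne_top, ?_, ?_⟩
  · intro x
    rw [← hΦrt]
    exact (e.symm_apply_apply x).symm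
  · have hΦ' : (fun p : ℝ × ℝ => p.1 • Φ (1, 0) + p.2 • Φ (0, 1)) = Φ :=
      funext fun p => (hΦrt p.1 p.2).symm
    rw [hΦ', hC]
    exact ⟨Φ.continuous.measurable, fun S hS => by simpa [hC0] using hS⟩
  · intro S hS
    have hm : Measurable Φ := Φ.continuous.measurable
    rw [hC, Measure.smul_apply, Measure.map_apply hm hS, Measure.volume_eq_prod,
      Measure.prod_apply_symm (hm hS)]
    simp only [← hΦrt]
    rfl

/-! ### One-dimensional estimates for slices -/

theorem volume_affine_preimage {a : ℝ} (ha : a ≠ 0) (q : ℝ) (S : Set ℝ) :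
    volume {r : ℝ | r * a + q ∈ S} = ENNReal.ofReal |a⁻¹| * volume S := by
  have : {r : ℝ | r * a + q ∈ S} = (· * a) ⁻¹' ((· + q) ⁻¹' S) := rfl
  rw [this, Real.volume_preimage_mul_right ha, measure_preimage_add_right]

/-- Truncating finitely many sets by mass `η` on either side decreases the measure of their
intersection by at most `2 η`. -/
theorem measure_iInter_le_truncate {ι : Type*} (μ : Measure ℝ) (s : Finset ι) (hs : s.Nonempty)
    (A : ι → Set ℝ) (l h : ι → ℝ) (η : ℝ≥0∞) (hl : ∀ j ∈ s, μ (A j ∩ Iio (l j)) ≤ η)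
    (hh : ∀ j ∈ s, μ (A j ∩ Ioi (h j)) ≤ η) :
    μ {r | ∀ j ∈ s, r ∈ A j} ≤ μ {r | ∀ j ∈ s, r ∈ A j ∩ Icc (l j) (h j)} + 2 * η := by
  -- Everything lost on the left lies below the largest lower cut, hence in a single `A i`, and
  -- likewise on the right; so the bound does not grow with the number of sets.
  obtain ⟨i, hi, hli⟩ := s.exists_max_image l hs
  obtain ⟨k, hk, hhk⟩ := s.exists_min_image h hs
  have hsub : {r | ∀ j ∈ s, r ∈ A j} ⊆ {r | ∀ j ∈ s, r ∈ A j ∩ Icc (l j) (h j)} ∪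
      (A i ∩ Iio (l i) ∪ A k ∩ Ioi (h k)) := by
    intro r hr
    by_cases h1 : r < l i
    · exact Or.inr (Or.inl ⟨hr i hi, h1⟩)
    by_cases h2 : h k < r
    · exact Or.inr (Or.inr ⟨hr k hk, h2⟩)
    push Not at h1 h2
    exact Or.inl fun j hj => ⟨hr j hj, (hli j hj).trans h1, h2.trans (hhk j hj)⟩
  calc _ ≤ _ := measure_mono hsub
    _ ≤ _ := measure_union_le _ _
    _ ≤ _ := by
      gcongr
      rw [two_mul]
      exact (measure_union_le _ _).trans (add_le_add (hl i hi) (hh k hk))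

/-- A set containing the `η`-neighbourhood of a nonempty compact set `K ⊆ ℝ` has measure at least
`|K| + 2 η`. -/
theorem volume_thickening_ge {K T : Set ℝ} (hK : IsCompact K) (hne : K.Nonempty) {η : ℝ}
    (hη : 0 ≤ η) (hT : ∀ r ∈ K, Icc (r - η) (r + η) ⊆ T) :
    volume K + 2 * ENNReal.ofReal η ≤ volume T := by
  -- One interval of length `η` to the left of the least point and one to the right of the greatest
  -- point are disjoint from `K`.
  obtain ⟨a, ha, hamin⟩ := hK.exists_isLeast hne
  obtain ⟨b, hb, hbmax⟩ := hK.exists_isGreatest hne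
  have h1 : Disjoint K (Ico (a - η) a) :=
    Set.disjoint_left.2 fun x hx hx' => (hamin hx).not_gt hx'.2
  have h2 : Disjoint (K ∪ Ico (a - η) a) (Ioc b (b + η)) := by
    refine Set.disjoint_left.2 ?_
    rintro x (hx | hx) hx'
    · exact (hbmax hx).not_gt hx'.1
    · exact absurd (hamin hb) (not_le.2 (hx'.1.trans hx.2))
  have hsub : K ∪ Ico (a - η) a ∪ Ioc b (b + η) ⊆ T := by
    rintro x ((hx | hx) | hx)
    · exact hT x hx ⟨by linarith, by linarith⟩
    · exact hT a ha ⟨hx.1, by linarith [hx.2]⟩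
    · exact hT b hb ⟨by linarith [hx.1], hx.2⟩
  calc volume K + 2 * ENNReal.ofReal η
      = volume (K ∪ Ico (a - η) a ∪ Ioc b (b + η)) := by
        rw [measure_union h2 measurableSet_Ioc, measure_union h1 measurableSet_Ico,
          Real.volume_Ico, Real.volume_Ioc, two_mul, ← add_assoc]
        congr 3 <;> ring
    _ ≤ _ := measure_mono hsub

/-! ### Distribution functions and symmetric truncation -/

/-- The mass of `A` on the left of `x`. -/
noncomputable def massBelow (A : Set ℝ) (x : ℝ) : ℝ := volume.real (A ∩ Iic x)

section massBelow
variable {A : Set ℝ}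

theorem massBelow_sub (hfin : volume A ≠ ∞) {x y : ℝ} (hxy : x ≤ y) :
    massBelow A y - massBelow A x = volume.real (A ∩ Ioc x y) := by
  have hd : Disjoint (A ∩ Iic x) (A ∩ Ioc x y) :=
    Set.disjoint_left.2 fun z hz hz' => hz'.2.1.not_ge hz.2
  have := measureReal_inter_add_sdiff₀ (μ := volume) (s := A ∩ Iic y) (t := Iic x)
    measurableSet_Iic.nullMeasurableSet (measure_ne_top_of_subset inter_subset_left hfin)
  have e1 : A ∩ Iic y ∩ Iic x = A ∩ Iic x := by
    ext z; simp only [mem_inter_iff, mem_Iic]; constructor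
    · rintro ⟨⟨a, b⟩, c⟩; exact ⟨a, c⟩
    · rintro ⟨a, c⟩; exact ⟨⟨a, c.trans hxy⟩, c⟩
  have e2 : (A ∩ Iic y) \ Iic x = A ∩ Ioc x y := by
    ext z; simp only [mem_inter_iff, mem_Iic, mem_sdiff, mem_Ioc, not_le]; tauto
  rw [e1, e2] at this
  unfold massBelow
  linarith

theorem massBelow_mono (hfin : volume A ≠ ∞) : Monotone (massBelow A) := fun x y hxy => by
  have := massBelow_sub hfin hxy
  have := measureReal_nonneg (μ := volume) (s := A ∩ Ioc x y)
  linarith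

theorem massBelow_sub_le (hfin : volume A ≠ ∞) {x y : ℝ} (hxy : x ≤ y) :
    massBelow A y - massBelow A x ≤ y - x := by
  rw [massBelow_sub hfin hxy]
  refine (measureReal_mono inter_subset_right (by simp)).trans ?_
  rw [Real.volume_real_Ioc_of_le hxy]

theorem massBelow_continuous (hfin : volume A ≠ ∞) : Continuous (massBelow A) := by
  refine (LipschitzWith.of_dist_le_mul (K := 1) fun x y => ?_).continuous
  simp only [NNReal.coe_one, one_mul, Real.dist_eq]
  rcases le_total x y with h | h
  · rw [abs_sub_comm, abs_sub_comm x, abs_of_nonneg (sub_nonneg.2 (massBelow_mono hfin h)),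
      abs_of_nonneg (sub_nonneg.2 h)]
    exact massBelow_sub_le hfin h
  · rw [abs_of_nonneg (sub_nonneg.2 (massBelow_mono hfin h)), abs_of_nonneg (sub_nonneg.2 h)]
    exact massBelow_sub_le hfin h

theorem massBelow_tendsto_atTop (hfin : volume A ≠ ∞) :
    Filter.Tendsto (massBelow A) Filter.atTop (nhds (volume.real A)) := by
  have := tendsto_measure_Iic_atTop (volume.restrict A)
  rw [Measure.restrict_apply_univ] at this
  refine ((ENNReal.tendsto_toReal hfin).comp this).congr fun x => ?_
  simp [massBelow, Measure.real, Measure.restrict_apply measurableSet_Iic, inter_comm]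

theorem massBelow_tendsto_atBot (hfin : volume A ≠ ∞) :
    Filter.Tendsto (massBelow A) Filter.atBot (nhds 0) := by
  have := tendsto_measure_Ici_atBot (volume.restrict A)
  rw [Measure.restrict_apply_univ] at this
  have h2 := ((ENNReal.tendsto_toReal hfin).comp this).const_sub (volume.real A)
  rw [← Measure.real, sub_self] at h2
  refine h2.congr fun x => ?_
  have h3 := measureReal_inter_add_sdiff₀ (μ := volume) (s := A) (t := Iio x)
    measurableSet_Iio.nullMeasurableSet hfin
  rw [sdiff_eq, compl_Iio, measureReal_congr (Filter.EventuallyEq.inter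
    (Filter.EventuallyEq.refl _ A) (Iio_ae_eq_Iic (a := x)))] at h3
  have h4 : ((volume.restrict A) (Ici x)).toReal = volume.real (A ∩ Ici x) := by
    simp [Measure.real, Measure.restrict_apply measurableSet_Ici, inter_comm]
  simp only [Function.comp_apply, h4]
  unfold massBelow
  linarith

theorem exists_massBelow_eq (hfin : volume A ≠ ∞) {m : ℝ} (h0 : 0 < m)
    (h1 : m < volume.real A) : ∃ x, massBelow A x = m := by
  obtain ⟨x, hx⟩ := ((massBelow_tendsto_atBot hfin).eventually (gt_mem_nhds h0)).exists
  obtain ⟨y, hy⟩ := ((massBelow_tendsto_atTop hfin).eventually (lt_mem_nhds h1)).exists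
  exact mem_range_of_exists_le_of_exists_ge (massBelow_continuous hfin) ⟨x, hx.le⟩ ⟨y, hy.le⟩

theorem massBelow_add_measureReal_Ioi (hfin : volume A ≠ ∞) (x : ℝ) :
    massBelow A x + volume.real (A ∩ Ioi x) = volume.real A := by
  have := measureReal_inter_add_sdiff₀ (μ := volume) (s := A) (t := Iic x)
    measurableSet_Iic.nullMeasurableSet hfin
  rwa [sdiff_eq, compl_Iic] at this

theorem measureReal_inter_Iio (x : ℝ) : volume.real (A ∩ Iio x) = massBelow A x :=
  measureReal_congr (Filter.EventuallyEq.inter (Filter.EventuallyEq.refl _ _) Iio_ae_eq_Iic)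

theorem massBelow_congr {B : Set ℝ} (h : A =ᵐ[volume] B) (x : ℝ) :
    massBelow A x = massBelow B x :=
  measureReal_congr (h.inter (Filter.EventuallyEq.refl _ _))

/-- Symmetric truncation: remove mass `m` from either end of a set. -/
theorem exists_truncation (hfin : volume A ≠ ∞) {m : ℝ} (h0 : 0 < m)
    (h1 : 2 * m < volume.real A) :
    ∃ l h, l ≤ h ∧ massBelow A l = m ∧ massBelow A h = volume.real A - m ∧
      volume (A ∩ Iio l) = ENNReal.ofReal m ∧ volume (A ∩ Ioi h) = ENNReal.ofReal m ∧
      volume (A ∩ Icc l h) = ENNReal.ofReal (volume.real A - 2 * m) := by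
  obtain ⟨l, hl⟩ := exists_massBelow_eq hfin h0 (by linarith)
  obtain ⟨h, hh⟩ := exists_massBelow_eq hfin (m := volume.real A - m) (by linarith) (by linarith)
  have hlh : l ≤ h := by
    by_contra hlt
    have := massBelow_mono hfin (not_le.1 hlt).le
    linarith
  have hsub : ∀ S, A ∩ S ⊆ A := fun S => inter_subset_left
  have key : ∀ S (r : ℝ), volume.real (A ∩ S) = r → volume (A ∩ S) = ENNReal.ofReal r := by
    intro S r hr
    rw [← hr, ofReal_measureReal (measure_ne_top_of_subset (hsub S) hfin)]
  refine ⟨l, h, hlh, hl, hh, key _ _ ?_, key _ _ ?_, key _ _ ?_⟩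
  · rw [measureReal_inter_Iio, hl]
  · linarith [massBelow_add_measureReal_Ioi hfin h]
  · have : volume.real (A ∩ Icc l h) = volume.real (A ∩ Ioc l h) :=
      measureReal_congr
        (Filter.EventuallyEq.inter (Filter.EventuallyEq.refl _ _) Ioc_ae_eq_Icc.symm)
    rw [this, ← massBelow_sub hfin hlh]
    linarith

end massBelow

/-! ### Strips in the plane and the cost of a truncation -/

/-- Any two of the linear forms are coordinates of the plane. -/
def PairwiseCoordinates {ι : Type*} (L : ι → (Fin 2 → ℝ) →ₗ[ℝ] ℝ) : Prop :=
  ∀ i j, i ≠ j → Function.Bijective fun x => (L i x, L j x)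

/-- The intersection of the preimages `L j ⁻¹' E j`, `j ∈ s`. -/
def cells {ι : Type*} (L : ι → (Fin 2 → ℝ) →ₗ[ℝ] ℝ) (s : Finset ι) (E : ι → Set ℝ) :
    Set (Fin 2 → ℝ) :=
  {x | ∀ j ∈ s, L j x ∈ E j}

/-- The intersection of the strips `|L j x| ≤ e j`, `j ∈ s`. -/
def poly {ι : Type*} (L : ι → (Fin 2 → ℝ) →ₗ[ℝ] ℝ) (s : Finset ι) (e : ι → ℝ) :
    Set (Fin 2 → ℝ) :=
  cells L s fun j => Icc (-e j) (e j)

section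
variable {ι : Type*} {L : ι → (Fin 2 → ℝ) →ₗ[ℝ] ℝ} {s : Finset ι}

theorem mem_poly {e : ι → ℝ} {x : Fin 2 → ℝ} : x ∈ poly L s e ↔ ∀ j ∈ s, |L j x| ≤ e j := by
  simp only [poly, cells, mem_ofPred_eq, mem_Icc, abs_le]

theorem continuous_linearForm (f : (Fin 2 → ℝ) →ₗ[ℝ] ℝ) : Continuous f :=
  f.continuous_of_finiteDimensional

theorem measurableSet_cells {E : ι → Set ℝ} (hE : ∀ j ∈ s, MeasurableSet (E j)) :
    MeasurableSet (cells L s E) := by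
  have : cells L s E = ⋂ j ∈ s, L j ⁻¹' E j := by ext x; simp [cells]
  rw [this]
  exact s.measurableSet_biInter fun j hj => (continuous_linearForm (L j)).measurable (hE j hj)

theorem measurableSet_poly {e : ι → ℝ} : MeasurableSet (poly L s e) :=
  measurableSet_cells fun _ _ => measurableSet_Icc

theorem cells_anti {t : Finset ι} (h : t ⊆ s) (E : ι → Set ℝ) : cells L s E ⊆ cells L t E :=
  fun _ hx j hj => hx j (h hj)

theorem PairwiseCoordinates.eq_zero (hL : PairwiseCoordinates L) {i j : ι} (hij : i ≠ j)
    {x : Fin 2 → ℝ} (hi : L i x = 0) (hj : L j x = 0) : x = 0 :=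
  (hL i j hij).1 (by simp [hi, hj])

theorem PairwiseCoordinates.exists_volume_pair (hL : PairwiseCoordinates L) {i j : ι}
    (hij : i ≠ j) : ∃ C : ℝ≥0∞, C ≠ 0 ∧ C ≠ ∞ ∧ ∀ A B : Set ℝ, MeasurableSet A → MeasurableSet B →
      volume {x | L i x ∈ A ∧ L j x ∈ B} = C * (volume A * volume B) := by
  obtain ⟨v, u, C, h1, h2, h3, h4, -, hC0, hC, -, hvol⟩ := exists_dual_slicing _ _ (hL i j hij)
  refine ⟨C, hC0, hC, fun A B hA hB => ?_⟩
  have hm : MeasurableSet {x | L i x ∈ A ∧ L j x ∈ B} := (((continuous_linearForm (L i)).measurable hA).inter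
    ((continuous_linearForm (L j)).measurable hB))
  rw [hvol _ hm]
  congr 1
  have : ∀ t : ℝ, volume {r : ℝ | r • v + t • u ∈ {x | L i x ∈ A ∧ L j x ∈ B}} =
      B.indicator (fun _ => volume A) t := by
    intro t
    by_cases ht : t ∈ B
    · simp [h1, h2, h3, h4, ht]
    · simp [h1, h2, h3, h4, ht]
  simp only [this, lintegral_indicator_const hB]

/-- Along lines parallel to `v` the form `L j` has speed `|L j v|`, so mass `η * |L j v|` in `E j`
becomes length `η` on each slice. Fubini turns the slicewise loss `2 * η` into the same expression
in both bounds: an upper bound for the loss of arbitrary sets, a lower bound for that of the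
polygon. -/
theorem PairwiseCoordinates.exists_truncation_bounds (hL : PairwiseCoordinates L) {n : ι}
    (hn : n ∈ s) (hs : 2 ≤ s.card) :
    ∃ (v : Fin 2 → ℝ) (C : ℝ≥0∞), L n v = 0 ∧ (∀ j, j ≠ n → L j v ≠ 0) ∧ C ≠ ∞ ∧
      (∀ (E E' : ι → Set ℝ) (η : ℝ), (∀ j ∈ s, MeasurableSet (E j)) →
        E' n = E n → (∀ j ∈ s, j ≠ n → ∃ l h, E' j = E j ∩ Icc l h ∧
          volume (E j ∩ Iio l) ≤ ENNReal.ofReal (η * |L j v|) ∧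
          volume (E j ∩ Ioi h) ≤ ENNReal.ofReal (η * |L j v|)) →
        volume (cells L s E) ≤
          volume (cells L s E') + C * (2 * ENNReal.ofReal η * volume (E n))) ∧
      (∀ (e : ι → ℝ) (η : ℝ), 0 ≤ η → 0 < e n →
        (∃ y ∈ poly L s (fun j => e j - η * |L j v|), L n y = e n) →
        volume (poly L s (fun j => e j - η * |L j v|)) +
          C * (2 * ENNReal.ofReal η * ENNReal.ofReal (2 * e n)) ≤ volume (poly L s e)) := by
  classical
  obtain ⟨i, hi, hin⟩ : ∃ i ∈ s, i ≠ n := s.exists_mem_ne (by omega) n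
  obtain ⟨v, u, C, hiv, hnv, hiu, hnu, hvu, -, hC, -, hvol⟩ :=
    exists_dual_slicing _ _ (hL i n hin)
  have hv : ∀ j, j ≠ n → L j v ≠ 0 := by
    intro j hj hjv
    have : v = 0 := hL.eq_zero hj hjv hnv
    simp [this] at hiv
  have hLn : ∀ r t : ℝ, L n (r • v + t • u) = t := by intro r t; simp [hnv, hnu]
  have hLj : ∀ j (r t : ℝ), L j (r • v + t • u) = r * L j v + t * L j u := by
    intro j r t; simp
  refine ⟨v, C, hnv, hv, hC, ?_, ?_⟩
  · intro E E' η hE hEn hEj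
    have hE' : ∀ j ∈ s, MeasurableSet (E' j) := by
      intro j hj
      by_cases hjn : j = n
      · rw [hjn, hEn]; exact hE n hn
      · obtain ⟨l, h, h1, -, -⟩ := hEj j hj hjn
        rw [h1]; exact (hE j hj).inter measurableSet_Icc
    rw [hvol _ (measurableSet_cells hE), hvol _ (measurableSet_cells hE'), ← mul_add,
      ← lintegral_indicator_const (hE n hn), ← lintegral_add_right _
        (measurable_const.indicator (hE n hn))]
    gcongr with t
    by_cases ht : t ∈ E n
    swap
    · have : {r : ℝ | r • v + t • u ∈ cells L s E} = ∅ :=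
        eq_empty_of_forall_notMem fun r hr => ht (by simpa [hLn] using hr n hn)
      simp [this]
    have hslice : ∀ F : ι → Set ℝ, F n = E n → {r : ℝ | r • v + t • u ∈ cells L s F} =
        {r : ℝ | ∀ j ∈ s.filter (· ≠ n), r ∈ {r | r * L j v + t * L j u ∈ F j}} := by
      intro F hF
      ext r
      simp only [cells, mem_ofPred_eq, Finset.mem_filter, hLj]
      constructor
      · exact fun h j hj => h j hj.1
      · intro h j hj
        by_cases hjn : j = n
        · rw [hjn, hnv, hnu, hF]; simpa using ht
        · exact h j ⟨hj, hjn⟩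
    have hcut : ∀ j ∈ s.filter (· ≠ n), ∃ l h : ℝ,
        {r | r * L j v + t * L j u ∈ E' j} =
          {r | r * L j v + t * L j u ∈ E j} ∩ Icc l h ∧
        volume ({r | r * L j v + t * L j u ∈ E j} ∩ Iio l) ≤ ENNReal.ofReal η ∧
        volume ({r | r * L j v + t * L j u ∈ E j} ∩ Ioi h) ≤ ENNReal.ofReal η := by
      intro j hj
      rw [Finset.mem_filter] at hj
      obtain ⟨l, h, h1, h2, h3⟩ := hEj j hj.1 hj.2
      have ha := hv j hj.2
      have hbound : ∀ S, volume S ≤ ENNReal.ofReal (η * |L j v|) →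
          volume {r | r * L j v + t * L j u ∈ S} ≤ ENNReal.ofReal η := by
        intro S hS
        rw [volume_affine_preimage ha]
        refine (mul_le_mul_right hS _).trans (le_of_eq ?_)
        rw [← ENNReal.ofReal_mul (abs_nonneg _), abs_inv]
        congr 1
        have := abs_ne_zero.2 ha
        field_simp
      -- If `L j v` is negative, the slice runs through `E j` backwards and the lower and upper cuts
      -- change roles.
      rcases lt_or_gt_of_ne ha with hneg | hpos
      · refine ⟨(h - t * L j u) / L j v, (l - t * L j u) / L j v, ?_, ?_, ?_⟩
        · rw [h1]
          ext r
          simp only [mem_ofPred_eq, mem_inter_iff, mem_Icc, div_le_iff_of_neg hneg,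
            le_div_iff_of_neg hneg]
          constructor
          · rintro ⟨a, b, c⟩; exact ⟨a, by linarith, by linarith⟩
          · rintro ⟨a, b, c⟩; exact ⟨a, by linarith, by linarith⟩
        · refine le_trans (measure_mono ?_) (hbound _ h3)
          rintro r ⟨a, b⟩
          rw [mem_Iio, lt_div_iff_of_neg hneg] at b
          exact ⟨a, by rw [mem_Ioi]; linarith⟩
        · refine le_trans (measure_mono ?_) (hbound _ h2)
          rintro r ⟨a, b⟩
          rw [mem_Ioi, div_lt_iff_of_neg hneg] at b
          exact ⟨a, by rw [mem_Iio]; linarith⟩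
      · refine ⟨(l - t * L j u) / L j v, (h - t * L j u) / L j v, ?_, ?_, ?_⟩
        · rw [h1]
          ext r
          simp only [mem_ofPred_eq, mem_inter_iff, mem_Icc, div_le_iff₀ hpos, le_div_iff₀ hpos]
          constructor
          · rintro ⟨a, b, c⟩; exact ⟨a, by linarith, by linarith⟩
          · rintro ⟨a, b, c⟩; exact ⟨a, by linarith, by linarith⟩
        · refine le_trans (measure_mono ?_) (hbound _ h2)
          rintro r ⟨a, b⟩
          rw [mem_Iio, lt_div_iff₀ hpos] at b
          exact ⟨a, by rw [mem_Iio]; linarith⟩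
        · refine le_trans (measure_mono ?_) (hbound _ h3)
          rintro r ⟨a, b⟩
          rw [mem_Ioi, div_lt_iff₀ hpos] at b
          exact ⟨a, by rw [mem_Ioi]; linarith⟩
    choose! l h hE'eq hl hh using hcut
    rw [hslice E rfl, hslice E' hEn, indicator_of_mem ht]
    have hne : (s.filter (· ≠ n)).Nonempty := ⟨i, Finset.mem_filter.2 ⟨hi, hin⟩⟩
    refine (measure_iInter_le_truncate volume _ hne _ l h _ hl hh).trans (le_of_eq ?_)
    congr 2
    ext r
    simp only [mem_ofPred_eq]
    refine forall₂_congr fun j hj => ?_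
    rw [← hE'eq j hj]
    rfl
  · rintro e η hη hen ⟨y, hy, hyn⟩
    have hvolI : ENNReal.ofReal (2 * e n) = volume (Icc (-e n) (e n)) := by
      rw [Real.volume_Icc]; congr 1; ring
    rw [hvol _ measurableSet_poly, hvol _ measurableSet_poly, ← mul_add, hvolI,
      ← lintegral_indicator_const measurableSet_Icc, ← lintegral_add_right _
        (measurable_const.indicator measurableSet_Icc)]
    gcongr with t
    by_cases ht : t ∈ Icc (-e n) (e n)
    swap
    · have : {r : ℝ | r • v + t • u ∈ poly L s fun j => e j - η * |L j v|} = ∅ := by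
        refine eq_empty_of_forall_notMem fun r hr => ht ?_
        have := mem_poly.1 hr n hn
        rw [hLn, hnv] at this
        rw [mem_Icc, ← abs_le]
        simpa using this
      simp [this, ht]
    rw [indicator_of_mem ht]
    refine volume_thickening_ge ?_ ?_ hη ?_
    · refine isCompact_Icc.of_isClosed_subset (s := Icc (-(e i - η * |L i v|)) (e i - η * |L i v|))
        ?_ ?_
      · have : {r : ℝ | r • v + t • u ∈ poly L s fun j => e j - η * |L j v|} =
            ⋂ j ∈ s, {r : ℝ | |r * L j v + t * L j u| ≤ e j - η * |L j v|} := by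
          ext r; simp [mem_poly]
        rw [this]
        refine isClosed_biInter fun j _ => isClosed_le (by fun_prop) (by fun_prop)
      · intro r hr
        have := mem_poly.1 hr i hi
        rw [hLj, hiu, hiv] at this
        rw [mem_Icc, ← abs_le, hiv]
        simpa using this
    -- The slice at height `t` is nonempty: the polygon is convex and symmetric, so it contains the
    -- multiple of the touching point `y` at that height.
    · refine ⟨L i ((t / e n) • y), ?_⟩
      have hw := hvu ((t / e n) • y)
      have hwn : L n ((t / e n) • y) = t := by simp [hyn, hen.ne']
      rw [hwn] at hw
      rw [mem_ofPred_eq, ← hw, mem_poly]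
      intro j hj
      have h1 : |t / e n| ≤ 1 := by
        rw [abs_div, abs_of_pos hen, div_le_one hen]; exact abs_le.2 ht
      rw [map_smul, smul_eq_mul, abs_mul]
      exact (mul_le_of_le_one_left (abs_nonneg _) h1).trans (mem_poly.1 hy j hj)
    · intro r hr r' hr'
      rw [mem_ofPred_eq, mem_poly] at hr ⊢
      intro j hj
      have h1 := hr j hj
      have h2 : |r' - r| ≤ η := abs_le.2 ⟨by linarith [hr'.1], by linarith [hr'.2]⟩
      rw [hLj] at h1 ⊢
      calc |r' * L j v + t * L j u| = |(r * L j v + t * L j u) + (r' - r) * L j v| := by ring_nf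
        _ ≤ |r * L j v + t * L j u| + |r' - r| * |L j v| := by
          rw [← abs_mul]; exact abs_add_le _ _
        _ ≤ (e j - η * |L j v|) + η * |L j v| := by gcongr
        _ = e j := by ring

end

/-! ### Touching, redundancy and the critical truncation -/

/-- Each strip `|L k x| ≤ e k` has a boundary line touching the polygon. -/
def Touching {ι : Type*} (L : ι → (Fin 2 → ℝ) →ₗ[ℝ] ℝ) (s : Finset ι) (e : ι → ℝ) : Prop :=
  ∀ k ∈ s, ∃ x ∈ poly L s e, L k x = e k

/-- The strip `|L k x| ≤ e k` contains the intersection of the other strips. -/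
def Redundant {ι : Type*} [DecidableEq ι] (L : ι → (Fin 2 → ℝ) →ₗ[ℝ] ℝ) (s : Finset ι)
    (e : ι → ℝ) (k : ι) : Prop :=
  ∀ x ∈ poly L (s.erase k) e, |L k x| ≤ e k

section
variable {ι : Type*} {L : ι → (Fin 2 → ℝ) →ₗ[ℝ] ℝ} {s : Finset ι}

theorem PairwiseCoordinates.isCompact_poly (hL : PairwiseCoordinates L) (hs : 2 ≤ s.card)
    (e : ι → ℝ) : IsCompact (poly L s e) := by
  obtain ⟨i, hi, j, hj, hij⟩ := Finset.one_lt_card.1 (show 1 < s.card by omega)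
  obtain ⟨v, u, C, -, -, -, -, hvu, -⟩ := exists_dual_slicing _ _ (hL i j hij)
  have hK : IsCompact ((fun p : ℝ × ℝ => p.1 • v + p.2 • u) ''
      (Icc (-e i) (e i) ×ˢ Icc (-e j) (e j))) :=
    (isCompact_Icc.prod isCompact_Icc).image (by fun_prop)
  refine hK.of_isClosed_subset ?_ ?_
  · have : poly L s e = ⋂ j ∈ s, {x | |L j x| ≤ e j} := by ext x; simp [mem_poly]
    rw [this]
    exact isClosed_biInter fun j _ =>
      isClosed_le (continuous_linearForm (L j)).abs continuous_const
  · intro x hx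
    exact ⟨(L i x, L j x), ⟨hx i hi, hx j hj⟩, (hvu x).symm⟩

theorem smul_mem_poly {e : ι → ℝ} {x : Fin 2 → ℝ} (hx : x ∈ poly L s e) {c : ℝ} (hc : |c| ≤ 1) :
    c • x ∈ poly L s e := by
  rw [mem_poly] at hx ⊢
  intro j hj
  rw [map_smul, smul_eq_mul, abs_mul]
  exact (mul_le_of_le_one_left (abs_nonneg _) hc).trans (hx j hj)

/-- Compactness supplies a greatest admissible truncation parameter. For each `k` the pairs of a
parameter and a touching point form a compact set, bounded because the width `e i - η * |L i v|`
cannot be negative; the set in question is a finite intersection of their projections. -/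
theorem PairwiseCoordinates.isCompact_touching (hL : PairwiseCoordinates L) (hs : 2 ≤ s.card)
    (e : ι → ℝ) {n : ι} {v : Fin 2 → ℝ} (hv : ∀ j, j ≠ n → L j v ≠ 0) :
    IsCompact {η : ℝ | 0 ≤ η ∧ Touching L s fun j => e j - η * |L j v|} := by
  obtain ⟨i, hi, hin⟩ : ∃ i ∈ s, i ≠ n := s.exists_mem_ne (by omega) n
  have hvi : 0 < |L i v| := abs_pos.2 (hv i hin)
  have hpoly : ∀ {η : ℝ}, 0 ≤ η → (poly L s fun j => e j - η * |L j v|) ⊆ poly L s e := by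
    intro η hη x hx
    rw [mem_poly] at hx ⊢
    intro j hj
    have := hx j hj
    have := mul_nonneg hη (abs_nonneg (L j v))
    linarith
  let T : ι → Set (ℝ × (Fin 2 → ℝ)) := fun k => {p | 0 ≤ p.1 ∧
    (∀ j ∈ s, |L j p.2| ≤ e j - p.1 * |L j v|) ∧ L k p.2 = e k - p.1 * |L k v|}
  have hcont : ∀ j, Continuous (L j) := fun j => continuous_linearForm (L j)
  have hT : ∀ k, IsCompact (T k) := by
    intro k
    refine (isCompact_Icc.prod (hL.isCompact_poly hs e) :
      IsCompact (Icc 0 (e i / |L i v|) ×ˢ poly L s e)).of_isClosed_subset ?_ ?_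
    · refine (isClosed_le continuous_const continuous_fst).inter (IsClosed.inter ?_ ?_)
      · have : {p : ℝ × (Fin 2 → ℝ) | ∀ j ∈ s, |L j p.2| ≤ e j - p.1 * |L j v|} =
            ⋂ j ∈ s, {p | |L j p.2| ≤ e j - p.1 * |L j v|} := by ext; simp
        change IsClosed {p : ℝ × (Fin 2 → ℝ) | ∀ j ∈ s, |L j p.2| ≤ e j - p.1 * |L j v|}
        rw [this]
        exact isClosed_biInter fun j _ =>
          isClosed_le ((hcont j).comp continuous_snd).abs (by fun_prop)
      · exact isClosed_eq ((hcont k).comp continuous_snd) (by fun_prop)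
    · rintro ⟨η, x⟩ ⟨h0, h1, -⟩
      refine ⟨⟨h0, ?_⟩, hpoly h0 (mem_poly.2 h1)⟩
      rw [le_div_iff₀ hvi]
      have := (abs_nonneg _).trans (h1 i hi)
      simpa using this
  have hEq : {η : ℝ | 0 ≤ η ∧ Touching L s fun j => e j - η * |L j v|} =
      ⋂ k ∈ s, Prod.fst '' T k := by
    ext η
    simp only [mem_ofPred_eq, mem_iInter, mem_image, Prod.exists, T, Touching, mem_poly]
    constructor
    · rintro ⟨h0, h⟩ k hk
      obtain ⟨x, hx, hxk⟩ := h k hk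
      exact ⟨η, x, ⟨h0, hx, hxk⟩, rfl⟩
    · intro h
      obtain ⟨_, _, ⟨h0, -⟩, rfl⟩ := h i hi
      refine ⟨h0, fun k hk => ?_⟩
      obtain ⟨_, x, ⟨-, hx, hxk⟩, rfl⟩ := h k hk
      exact ⟨x, hx, hxk⟩
  rw [hEq]
  refine ((hT i).image continuous_fst).of_isClosed_subset ?_ (biInter_subset_of_mem hi)
  exact isClosed_biInter fun k _ => ((hT k).image continuous_fst).isClosed

variable [DecidableEq ι]

/-- Scaling `x` towards the origin until it meets the boundary of the strip `k` keeps it in all the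
other strips. -/
theorem exists_mem_poly_eq {e : ι → ℝ} {k : ι} (hek : 0 < e k) {x : Fin 2 → ℝ}
    (hx : x ∈ poly L (s.erase k) e) (hk : e k ≤ |L k x|) : ∃ y ∈ poly L s e, L k y = e k := by
  have hpos : 0 < |L k x| := hek.trans_le hk
  have h0 : L k x ≠ 0 := abs_pos.1 hpos
  have hy : L k ((e k / L k x) • x) = e k := by simp [h0]
  refine ⟨(e k / L k x) • x, ?_, hy⟩
  have h1 : |e k / L k x| ≤ 1 := by
    rw [abs_div, abs_of_pos hek]; exact (div_le_one hpos).2 hk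
  rw [mem_poly]
  intro j hj
  by_cases hjk : j = k
  · rw [hjk, hy, abs_of_pos hek]
  · exact mem_poly.1 (smul_mem_poly hx h1) j (Finset.mem_erase.2 ⟨hjk, hj⟩)

/-- The value sought is the greatest `η` at which all strips still touch. Non-redundancy is an open
condition that implies touching, so at this `η` some strip must be redundant; hence also `η ≠ 0`. -/
theorem PairwiseCoordinates.exists_truncation_parameter (hL : PairwiseCoordinates L)
    (hs : 3 ≤ s.card) {e : ι → ℝ} (he : ∀ j ∈ s, 0 < e j) (hred : ∀ k ∈ s, ¬ Redundant L s e k)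
    {n : ι} (hn : n ∈ s) {v : Fin 2 → ℝ} (hnv : L n v = 0) (hv : ∀ j, j ≠ n → L j v ≠ 0) :
    ∃ η : ℝ, 0 < η ∧ (∀ j ∈ s, 0 < e j - η * |L j v|) ∧
      (Touching L s fun j => e j - η * |L j v|) ∧
      ∃ k ∈ s, Redundant L s (fun j => e j - η * |L j v|) k := by
  have hcomp := hL.isCompact_touching (by omega : 2 ≤ s.card) e hv
  have h0mem : (0 : ℝ) ∈ {η : ℝ | 0 ≤ η ∧ Touching L s fun j => e j - η * |L j v|} := by
    refine ⟨le_rfl, fun k hk => ?_⟩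
    simp only [zero_mul, sub_zero]
    have := hred k hk
    unfold Redundant at this
    push Not at this
    obtain ⟨x, hx, hxk⟩ := this
    exact exists_mem_poly_eq (he k hk) hx hxk.le
  obtain ⟨η, ⟨hη0, htouch⟩, hmax⟩ := hcomp.exists_isGreatest ⟨0, h0mem⟩
  have hnonneg : ∀ j ∈ s, 0 ≤ e j - η * |L j v| := by
    intro j hj
    obtain ⟨x, hx, -⟩ := htouch j hj
    exact (abs_nonneg _).trans (mem_poly.1 hx j hj)
  have hpos : ∀ j ∈ s, 0 < e j - η * |L j v| := by
    intro j hj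
    refine (hnonneg j hj).lt_of_ne fun hzero => ?_
    by_cases hjn : j = n
    · have := he n hn
      rw [hjn, hnv] at hzero
      simp only [abs_zero, mul_zero, sub_zero] at hzero
      exact this.ne hzero
    -- If the strip `j` had shrunk to a line, that line would contain the point `y` where the strip
    -- `n` touches. Then `y` and `v` span the parallelogram of the original strips `j` and `n`,
    -- which would lie inside any third strip `k`, making `k` redundant from the start.
    obtain ⟨y, hy, hyn⟩ := htouch n hn
    simp only [hnv, abs_zero, mul_zero, sub_zero] at hyn
    have hyj : L j y = 0 := by
      have := mem_poly.1 hy j hj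
      rw [← hzero] at this
      exact abs_eq_zero.1 (le_antisymm this (abs_nonneg _))
    obtain ⟨k, hk, hkj⟩ : ∃ k ∈ s, k ∉ ({j, n} : Finset ι) := by
      by_contra hcon
      push Not at hcon
      have := Finset.card_le_card (show s ⊆ {j, n} from hcon)
      have := Finset.card_le_two (a := j) (b := n)
      omega
    simp only [Finset.mem_insert, Finset.mem_singleton, not_or] at hkj
    refine hred k hk fun x hx => ?_
    have hxj := mem_poly.1 hx j (Finset.mem_erase.2 ⟨Ne.symm hkj.1, hj⟩)
    have hxn := mem_poly.1 hx n (Finset.mem_erase.2 ⟨Ne.symm hkj.2, hn⟩)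
    have hvj : 0 < |L j v| := abs_pos.2 (hv j hjn)
    have hen := he n hn
    have hdec : x = (L n x / e n) • y + (L j x / L j v) • v := by
      have : x - ((L n x / e n) • y + (L j x / L j v) • v) = 0 := by
        refine hL.eq_zero hjn ?_ ?_
        · simp [hyj, abs_pos.1 hvj]
        · simp [hyn, hnv, hen.ne']
      exact sub_eq_zero.1 this
    have h1 : |L n x / e n| ≤ 1 := by
      rw [abs_div, abs_of_pos hen]; exact (div_le_one hen).2 hxn
    have h2 : |L j x / L j v| ≤ η := by
      rw [abs_div, div_le_iff₀ hvj]; linarith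
    have hyk := mem_poly.1 hy k hk
    rw [hdec, map_add, map_smul, map_smul, smul_eq_mul, smul_eq_mul]
    calc _ ≤ |L n x / e n| * |L k y| + |L j x / L j v| * |L k v| := by
          rw [← abs_mul, ← abs_mul]; exact abs_add_le _ _
      _ ≤ 1 * (e k - η * |L k v|) + η * |L k v| := by gcongr
      _ = e k := by ring
  have hexists : ∃ k ∈ s, Redundant L s (fun j => e j - η * |L j v|) k := by
    by_contra hcon
    push Not at hcon
    have hev : ∀ᶠ ε in nhdsWithin (0 : ℝ) (Ioi 0), ∀ k ∈ s,
        ∃ x ∈ poly L s (fun j => e j - (η + ε) * |L j v|), L k x = e k - (η + ε) * |L k v| := by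
      rw [Filter.eventually_all_finset]
      intro k hk
      have := hcon k hk
      unfold Redundant at this
      push Not at this
      obtain ⟨x, hx, hxk⟩ := this
      have hxpos := (hpos k hk).trans hxk
      -- The factor `c` brings `x` back to the boundary of the strip `k`. As `c < 1`, this leaves
      -- strict slack in the other strips, so `η` could be increased slightly.
      set c := (e k - η * |L k v|) / |L k x| with hc
      have hc0 : 0 < c := div_pos (hpos k hk) hxpos
      have hc1 : c < 1 := (div_lt_one hxpos).2 hxk
      have hlim : ∀ j ∈ s, ∀ᶠ ε in nhdsWithin (0 : ℝ) (Ioi 0),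
          c * (e j - η * |L j v|) < e j - (η + ε) * |L j v| := by
        intro j hj
        have hcont : Continuous fun ε : ℝ => e j - (η + ε) * |L j v| := by fun_prop
        refine (hcont.tendsto 0).mono_left nhdsWithin_le_nhds |>.eventually (lt_mem_nhds ?_)
        rw [add_zero]
        exact mul_lt_of_lt_one_left (hpos j hj) hc1
      filter_upwards [(Filter.eventually_all_finset s).2 hlim, self_mem_nhdsWithin] with ε hε hε0
      refine exists_mem_poly_eq (e := fun j => e j - (η + ε) * |L j v|) (x := c • x) ?_ ?_ ?_
      · exact (mul_pos hc0 (hpos k hk)).trans (hε k hk)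
      · rw [mem_poly] at hx ⊢
        intro j hj
        rw [map_smul, smul_eq_mul, abs_mul, abs_of_pos hc0]
        exact (mul_le_mul_of_nonneg_left (hx j hj) hc0.le).trans
          (hε j (Finset.mem_of_mem_erase hj)).le
      · rw [map_smul, smul_eq_mul, abs_mul, abs_of_pos hc0, hc, div_mul_cancel₀ _ hxpos.ne']
        have := mul_nonneg (le_of_lt hε0) (abs_nonneg (L k v))
        linarith
    obtain ⟨ε, hε, hε0⟩ := (hev.and self_mem_nhdsWithin).exists
    have := hmax (show η + ε ∈ _ from ⟨by linarith, hε⟩)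
    linarith
  refine ⟨η, hη0.lt_of_ne ?_, hpos, htouch, hexists⟩
  rintro rfl
  obtain ⟨k, hk, hR⟩ := hexists
  simp only [zero_mul, sub_zero] at hR
  exact hred k hk hR

end

/-! ### The rearrangement inequality -/

section
variable {ι : Type*} {L : ι → (Fin 2 → ℝ) →ₗ[ℝ] ℝ} {s : Finset ι} {E : ι → Set ℝ} {e : ι → ℝ}
variable [DecidableEq ι]

/-- If no strip is redundant, truncate all sets but the `n`-th one until some strip becomes
redundant; the truncation costs at most as much as for the centered intervals. -/
theorem PairwiseCoordinates.exists_truncated (hL : PairwiseCoordinates L) (hs : 3 ≤ s.card)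
    (hE : ∀ j ∈ s, MeasurableSet (E j)) (he : ∀ j ∈ s, 0 < e j)
    (hEe : ∀ j ∈ s, volume (E j) = ENNReal.ofReal (2 * e j))
    (hred : ∀ k ∈ s, ¬ Redundant L s e k) {n : ι} (hn : n ∈ s) :
    ∃ (E' : ι → Set ℝ) (e' : ι → ℝ) (D : ℝ≥0∞),
      (∀ j ∈ s, MeasurableSet (E' j)) ∧ (∀ j ∈ s, 0 < e' j) ∧
      (∀ j ∈ s, volume (E' j) = ENNReal.ofReal (2 * e' j)) ∧ Touching L s e' ∧
      (∃ k ∈ s, Redundant L s e' k) ∧ E' n = E n ∧ e' n = e n ∧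
      (∀ j ∈ s, j ≠ n → ∃ l h m, E' j = E j ∩ Icc l h ∧ 0 < m ∧ m < e j ∧ e' j = e j - m ∧
        massBelow (E j) l = m ∧ massBelow (E j) h = volume.real (E j) - m) ∧
      D ≠ ∞ ∧ volume (cells L s E) ≤ volume (cells L s E') + D ∧
      volume (poly L s e') + D ≤ volume (poly L s e) := by
  obtain ⟨v, C, hnv, hv, hC, hcells, hpoly⟩ := hL.exists_truncation_bounds hn (by omega)
  obtain ⟨η, hη, hpos, htouch, hk⟩ := hL.exists_truncation_parameter hs he hred hn hnv hv
  have hreal : ∀ j ∈ s, volume.real (E j) = 2 * e j := by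
    intro j hj
    rw [Measure.real, hEe j hj, ENNReal.toReal_ofReal (by linarith [he j hj])]
  have hfin : ∀ j ∈ s, volume (E j) ≠ ∞ := fun j hj => by rw [hEe j hj]; exact ENNReal.ofReal_ne_top
  have hm : ∀ j, j ≠ n → 0 < η * |L j v| := fun j hj => mul_pos hη (abs_pos.2 (hv j hj))
  have htr : ∀ j ∈ s, j ≠ n → ∃ l h, l ≤ h ∧ massBelow (E j) l = η * |L j v| ∧
      massBelow (E j) h = volume.real (E j) - η * |L j v| ∧
      volume (E j ∩ Iio l) = ENNReal.ofReal (η * |L j v|) ∧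
      volume (E j ∩ Ioi h) = ENNReal.ofReal (η * |L j v|) ∧
      volume (E j ∩ Icc l h) = ENNReal.ofReal (volume.real (E j) - 2 * (η * |L j v|)) := by
    intro j hj hjn
    refine exists_truncation (hfin j hj) (hm j hjn) ?_
    rw [hreal j hj]
    linarith [hpos j hj]
  choose! l h hlh hl hh hvl hvh hvE using htr
  refine ⟨fun j => if j = n then E j else E j ∩ Icc (l j) (h j), fun j => e j - η * |L j v|,
    -- The common cost `D`: length `2 * η` on each slice with height in `E n`, times the Jacobian
    -- `C`.
    C * (2 * ENNReal.ofReal η * volume (E n)), ?_, hpos, ?_, htouch, hk, by simp, by simp [hnv],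
    ?_, ?_, ?_, ?_⟩
  · intro j hj
    by_cases hjn : j = n
    · simpa [hjn] using hE n hn
    · simpa [hjn] using (hE j hj).inter measurableSet_Icc
  · intro j hj
    by_cases hjn : j = n
    · simp [hjn, hnv, hEe n hn]
    · simp only [hjn, if_false]
      rw [hvE j hj hjn, hreal j hj]
      congr 1; ring
  · intro j hj hjn
    exact ⟨l j, h j, η * |L j v|, by simp [hjn], hm j hjn, by linarith [hpos j hj], rfl,
      hl j hj hjn, hh j hj hjn⟩
  · exact ENNReal.mul_ne_top hC (ENNReal.mul_ne_top
      (ENNReal.mul_ne_top (by simp) ENNReal.ofReal_ne_top) (hfin n hn))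
  · refine hcells E _ η hE (by simp) fun j hj hjn => ⟨l j, h j, by simp [hjn],
      (hvl j hj hjn).le, (hvh j hj hjn).le⟩
  · rw [hEe n hn]
    refine hpoly e η hη.le (he n hn) ?_
    simpa [hnv] using htouch n hn

-- In the coordinates given by the two forms both sets are products, so only the lengths of the
-- factors matter.
omit [DecidableEq ι] in
theorem PairwiseCoordinates.volume_cells_eq_of_card_two (hL : PairwiseCoordinates L)
    (hs : s.card = 2) (hE : ∀ j ∈ s, MeasurableSet (E j)) (he : ∀ j ∈ s, 0 < e j)
    (hEe : ∀ j ∈ s, volume (E j) = ENNReal.ofReal (2 * e j)) :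
    volume (cells L s E) = volume (poly L s e) := by
  classical
  obtain ⟨i, j, hij, rfl⟩ := Finset.card_eq_two.1 hs
  obtain ⟨C, -, -, hC⟩ := hL.exists_volume_pair hij
  have hcells : ∀ F : ι → Set ℝ, cells L {i, j} F = {x | L i x ∈ F i ∧ L j x ∈ F j} := by
    intro F; ext x; simp [cells]
  have hI : ∀ k ∈ ({i, j} : Finset ι), volume (Icc (-e k) (e k)) = volume (E k) := by
    intro k hk
    rw [hEe k hk, Real.volume_Icc]; congr 1; ring
  rw [poly, hcells, hcells, hC _ _ (hE i (by simp)) (hE j (by simp)),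
    hC _ _ measurableSet_Icc measurableSet_Icc, hI i (by simp), hI j (by simp)]

omit [DecidableEq ι] in
theorem PairwiseCoordinates.volume_poly_ne_top (hL : PairwiseCoordinates L) (hs : 2 ≤ s.card) :
    volume (poly L s e) ≠ ∞ :=
  (hL.isCompact_poly hs e).measure_lt_top.ne

theorem Redundant.poly_erase {k : ι} (h : Redundant L s e k) :
    poly L (s.erase k) e = poly L s e := by
  refine Subset.antisymm (fun x hx => ?_) (cells_anti (Finset.erase_subset _ _) _)
  rw [mem_poly]
  intro j hj
  by_cases hjk : j = k
  · rw [hjk]; exact h x hx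
  · exact mem_poly.1 hx j (Finset.mem_erase.2 ⟨hjk, hj⟩)

/-- The rearrangement inequality of Brascamp, Lieb and Luttinger in the plane. -/
theorem PairwiseCoordinates.volume_cells_le (hL : PairwiseCoordinates L) (hs : 2 ≤ s.card)
    (hE : ∀ j ∈ s, MeasurableSet (E j)) (he : ∀ j ∈ s, 0 < e j)
    (hEe : ∀ j ∈ s, volume (E j) = ENNReal.ofReal (2 * e j)) :
    volume (cells L s E) ≤ volume (poly L s e) := by
  obtain ⟨N, hN⟩ : ∃ N, s.card = N + 2 := ⟨s.card - 2, by omega⟩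
  induction N generalizing s E e with
  | zero => exact (hL.volume_cells_eq_of_card_two hN hE he hEe).le
  | succ N ih =>
    have hdrop : ∀ (E : ι → Set ℝ) (e : ι → ℝ), (∀ j ∈ s, MeasurableSet (E j)) →
        (∀ j ∈ s, 0 < e j) → (∀ j ∈ s, volume (E j) = ENNReal.ofReal (2 * e j)) →
        (∃ k ∈ s, Redundant L s e k) → volume (cells L s E) ≤ volume (poly L s e) := by
      rintro E e hE he hEe ⟨k, hk, hR⟩
      have hcard : (s.erase k).card = N + 2 := by rw [Finset.card_erase_of_mem hk]; omega
      rw [← hR.poly_erase]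
      exact (measure_mono (cells_anti (Finset.erase_subset _ _) _)).trans
        (ih (by omega) (fun j hj => hE j (Finset.mem_of_mem_erase hj))
          (fun j hj => he j (Finset.mem_of_mem_erase hj))
          (fun j hj => hEe j (Finset.mem_of_mem_erase hj)) hcard)
    by_cases hred : ∃ k ∈ s, Redundant L s e k
    · exact hdrop E e hE he hEe hred
    push Not at hred
    obtain ⟨n, hn⟩ : s.Nonempty := Finset.card_pos.1 (by omega)
    obtain ⟨E', e', D, h1, h2, h3, -, h4, -, -, -, -, h5, h6⟩ :=
      hL.exists_truncated (by omega) hE he hEe hred hn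
    calc _ ≤ volume (cells L s E') + D := h5
      _ ≤ volume (poly L s e') + D := add_le_add (hdrop E' e' h1 h2 h3 h4) le_rfl
      _ ≤ _ := h6

end

/-! ### Brunn–Minkowski on the line and its equality case -/

theorem measureReal_le_of_ae_add_mem {S T : Set ℝ} (hT : volume T ≠ ∞) (b : ℝ)
    (h : ∀ᵐ x : ℝ, x ∈ S → x + b ∈ T) : volume.real S ≤ volume.real T := by
  have h1 : volume S ≤ volume T := by
    rw [← measure_preimage_add_right volume b T]
    exact measure_mono_ae h
  exact ENNReal.toReal_mono hT h1

/-- The Brunn–Minkowski inequality on the line, for sumsets up to null sets. -/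
theorem measureReal_add_le_of_ae_add_mem {A B C : Set ℝ} (hA : volume A ≠ ∞) (hB : volume B ≠ ∞)
    (hC : volume C ≠ ∞) (hA0 : 0 < volume.real A) (hB0 : 0 < volume.real B)
    (h : ∀ᵐ p : ℝ × ℝ, p.1 ∈ A → p.2 ∈ B → p.1 + p.2 ∈ C) :
    volume.real A + volume.real B ≤ volume.real C := by
  have hAB : ∀ᵐ a : ℝ, ∀ᵐ b : ℝ, a ∈ A → b ∈ B → a + b ∈ C :=
    Measure.ae_ae_of_ae_prod (μ := volume) (ν := volume) h
  have hBA : ∀ᵐ b : ℝ, ∀ᵐ a : ℝ, a ∈ A → b ∈ B → a + b ∈ C :=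
    Measure.ae_ae_of_ae_prod (μ := volume) (ν := volume)
      ((Measure.measurePreserving_swap (μ := volume) (ν := volume)).quasiMeasurePreserving.ae h)
  have hpick : ∀ {S : Set ℝ} {p : ℝ → Prop}, 0 < volume.real S → (∀ᵐ x : ℝ, p x) →
      ∃ x ∈ S, p x := by
    intro S p hS hp
    by_contra hcon
    push Not at hcon
    have : volume S = 0 := measure_mono_null (fun x hx => hcon x hx) (ae_iff.1 hp)
    simp [Measure.real, this] at hS
  refine le_of_forall_pos_le_add fun δ hδ => ?_
  obtain ⟨ε, hε, hεδ⟩ : ∃ ε, 0 < ε ∧ ε < min δ (min (volume.real A) (volume.real B)) / 2 := by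
    exact exists_between (half_pos (lt_min hδ (lt_min hA0 hB0)))
  have h1 := min_le_left δ (min (volume.real A) (volume.real B))
  have h2 := (min_le_right δ (min (volume.real A) (volume.real B))).trans (min_le_left _ _)
  have h3 := (min_le_right δ (min (volume.real A) (volume.real B))).trans (min_le_right _ _)
  -- Choose `a` near the top of `A` and `b` near the bottom of `B`. Up to null sets, `C` contains
  -- the part of `A` below `a` shifted by `b`, and the part of `B` above `b` shifted by `a`. They
  -- lie on opposite sides of `a + b`, and only mass `2 * ε < δ` is lost.
  obtain ⟨x, hx⟩ := exists_massBelow_eq hA (m := volume.real A - ε) (by linarith) (by linarith)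
  obtain ⟨y, hy⟩ := exists_massBelow_eq hB hε (by linarith)
  obtain ⟨a, ⟨haA, hax⟩, ha⟩ : ∃ a ∈ A ∩ Ioi x, ∀ᵐ b : ℝ, a ∈ A → b ∈ B → a + b ∈ C :=
    hpick (by linarith [massBelow_add_measureReal_Ioi hA x]) hAB
  obtain ⟨b, ⟨hbB, hby⟩, hb⟩ : ∃ b ∈ B ∩ Iic y, ∀ᵐ a : ℝ, a ∈ A → b ∈ B → a + b ∈ C :=
    hpick (by rw [← massBelow, hy]; exact hε) hBA
  have hax' := massBelow_mono hA (le_of_lt hax)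
  have hby' := massBelow_mono hB hby
  have i1 : massBelow A a ≤ massBelow C (a + b) := by
    refine measureReal_le_of_ae_add_mem (measure_ne_top_of_subset inter_subset_left hC) b ?_
    filter_upwards [hb] with z hz hzA
    exact ⟨hz hzA.1 hbB, by have := hzA.2; rw [mem_Iic] at this ⊢; linarith⟩
  have i2 : volume.real (B ∩ Ioi b) ≤ volume.real (C ∩ Ioi (a + b)) := by
    refine measureReal_le_of_ae_add_mem (measure_ne_top_of_subset inter_subset_left hC) a ?_
    filter_upwards [ha] with z hz hzB
    rw [add_comm z a]
    exact ⟨hz haA hzB.1, by have := hzB.2; rw [mem_Ioi] at this ⊢; linarith⟩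
  linarith [massBelow_add_measureReal_Ioi hC (a + b), massBelow_add_measureReal_Ioi hB b]

theorem massBelow_eq_add_integral {A : Set ℝ} (hA : volume A ≠ ∞) (hAm : MeasurableSet A)
    (c x : ℝ) : massBelow A x = massBelow A c + ∫ t in c..x, A.indicator (fun _ => (1 : ℝ)) t := by
  have key : ∀ {c x : ℝ}, c ≤ x →
      ∫ t in c..x, A.indicator (fun _ => (1 : ℝ)) t = massBelow A x - massBelow A c := by
    intro c x h
    rw [intervalIntegral.integral_of_le h, integral_indicator_const _ hAm, smul_eq_mul, mul_one,
      massBelow_sub hA h, measureReal_restrict_apply hAm]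
  rcases le_total c x with h | h
  · rw [key h]; ring
  · rw [intervalIntegral.integral_symm, key h]; ring

theorem ae_hasDerivAt_massBelow {A : Set ℝ} (hA : volume A ≠ ∞) (hAm : MeasurableSet A) :
    ∀ᵐ x : ℝ, x ∈ A → HasDerivAt (massBelow A) 1 x := by
  have hint : LocallyIntegrable (A.indicator fun _ => (1 : ℝ)) volume :=
    ((integrable_indicator_iff hAm).2 (integrableOn_const hA)).locallyIntegrable
  filter_upwards [LocallyIntegrable.ae_hasDerivAt_integral hint] with x hx hxA
  have := (hx 0).const_add (massBelow A 0)
  rw [indicator_of_mem hxA] at this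
  rwa [← funext (massBelow_eq_add_integral hA hAm 0)] at this

/-- A set whose distribution function has slope `1` wherever it is not constant is an interval. -/
theorem ae_eq_Icc_of_hasDerivAt_massBelow {A : Set ℝ} (hA : volume A ≠ ∞) (hAm : MeasurableSet A) {e : ℝ} (he : 0 < e)
    (hAe : volume.real A = 2 * e)
    (hd : ∀ x, 0 < massBelow A x → massBelow A x < volume.real A →
      HasDerivAt (massBelow A) 1 x) :
    ∃ c, A =ᵐ[volume] Icc (c - e) (c + e) := by
  -- Where the distribution function is strictly between its extremes, it differs from the identity
  -- by a constant. So the whole mass `2 * e` sits in an interval of length `2 * e`.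
  have hslope : ∀ x y, x ≤ y → 0 < massBelow A x → massBelow A y < volume.real A →
      massBelow A y - y = massBelow A x - x := by
    intro x y hxy hx hy
    refine constant_of_has_deriv_right_zero (f := fun z => massBelow A z - z)
      ((massBelow_continuous hA).sub continuous_id).continuousOn (fun z hz => ?_) y ⟨hxy, le_rfl⟩
    have := ((hd z (hx.trans_le (massBelow_mono hA hz.1))
      ((massBelow_mono hA hz.2.le).trans_lt hy)).sub (hasDerivAt_id z)).hasDerivWithinAt (s := Ici z)
    rw [sub_self] at this
    exact this
  obtain ⟨c, hc⟩ := exists_massBelow_eq hA (m := e) he (by linarith)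
  have hin : ∀ t ∈ Ioo (-e) e, massBelow A (c + t) = e + t := by
    intro t ht
    obtain ⟨x, hx⟩ := exists_massBelow_eq hA (m := e + t) (by linarith [ht.1])
      (by linarith [ht.2])
    have : x = c + t := by
      rcases le_total c x with h | h
      · have := hslope c x h (by linarith) (by linarith [ht.2])
        linarith
      · have := hslope x c h (by linarith [ht.1]) (by linarith)
        linarith
    rw [← this, hx]
  have hcl : ∀ t ∈ Icc (-e) e, massBelow A (c + t) = e + t := by
    have hclosed : IsClosed {t | massBelow A (c + t) = e + t} :=
      isClosed_eq ((massBelow_continuous hA).comp (by fun_prop)) (by fun_prop)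
    have := hclosed.closure_subset_iff.2 (show Ioo (-e) e ⊆ _ from hin)
    rwa [closure_Ioo (by linarith)] at this
  refine ⟨c, ?_⟩
  have h1 := hcl (-e) ⟨le_rfl, by linarith⟩
  have h2 := hcl e ⟨by linarith, le_rfl⟩
  have hmass : volume.real (A ∩ Ioc (c - e) (c + e)) = 2 * e := by
    rw [← massBelow_sub hA (by linarith), h2, sub_eq_add_neg c e, h1]; ring
  have hfinI : volume (A ∩ Ioc (c - e) (c + e)) ≠ ∞ := measure_ne_top_of_subset inter_subset_left hA
  have hI : volume (A ∩ Ioc (c - e) (c + e)) = ENNReal.ofReal (2 * e) := by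
    rw [← hmass, ofReal_measureReal hfinI]
  have hm : NullMeasurableSet (A ∩ Ioc (c - e) (c + e)) :=
    (hAm.inter measurableSet_Ioc).nullMeasurableSet
  have hAI : (A ∩ Ioc (c - e) (c + e) : Set ℝ) =ᵐ[volume] (Ioc (c - e) (c + e) : Set ℝ) := by
    refine ae_eq_of_subset_of_measure_ge inter_subset_right ?_ hm (by simp)
    rw [hI, Real.volume_Ioc]
    exact ENNReal.ofReal_le_ofReal (by linarith)
  have hAA : (A ∩ Ioc (c - e) (c + e) : Set ℝ) =ᵐ[volume] A := by
    refine ae_eq_of_subset_of_measure_ge inter_subset_left ?_ hm hA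
    rw [hI, ← hAe, ofReal_measureReal hA]
  exact (hAA.symm.trans hAI).trans Ioc_ae_eq_Icc

/-- Equality in the Brunn–Minkowski inequality on the line, for sumsets up to null sets. -/
theorem ae_eq_Icc_of_ae_add_mem {A B C : Set ℝ} (hA : volume A ≠ ∞) (hB : volume B ≠ ∞)
    (hC : volume C ≠ ∞) (hAm : MeasurableSet A) (hBm : MeasurableSet B) {e : ℝ} (he : 0 < e)
    (hAe : volume.real A = 2 * e) (hB0 : 0 < volume.real B)
    (h : ∀ᵐ p : ℝ × ℝ, p.1 ∈ A → p.2 ∈ B → p.1 + p.2 ∈ C)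
    (hABC : volume.real C ≤ volume.real A + volume.real B) :
    ∃ c, A =ᵐ[volume] Icc (c - e) (c + e) := by
  have hfin : ∀ {X : Set ℝ} (_ : volume X ≠ ∞) (Y : Set ℝ), volume (X ∩ Y) ≠ ∞ :=
    fun hX Y => measure_ne_top_of_subset inter_subset_left hX
  -- Cut `A` at `x`, `B` at `y` and `C` at `x + y`, and apply the inequality to the lower and to the
  -- upper parts. Equality in total forces equality in each, so distribution functions add.
  have hsum : ∀ x y, 0 < massBelow A x → massBelow A x < volume.real A → 0 < massBelow B y →
      massBelow B y < volume.real B → massBelow C (x + y) = massBelow A x + massBelow B y := by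
    intro x y hx hx' hy hy'
    have hAx := massBelow_add_measureReal_Ioi hA x
    have hBy := massBelow_add_measureReal_Ioi hB y
    have hCxy := massBelow_add_measureReal_Ioi hC (x + y)
    have i1 : massBelow A x + massBelow B y ≤ massBelow C (x + y) := by
      refine measureReal_add_le_of_ae_add_mem (hfin hA _) (hfin hB _) (hfin hC _) hx hy ?_
      filter_upwards [h] with p hp hpA hpB
      exact ⟨hp hpA.1 hpB.1, add_le_add (mem_Iic.1 hpA.2) (mem_Iic.1 hpB.2)⟩
    have i2 : volume.real (A ∩ Ioi x) + volume.real (B ∩ Ioi y) ≤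
        volume.real (C ∩ Ioi (x + y)) := by
      refine measureReal_add_le_of_ae_add_mem (hfin hA _) (hfin hB _) (hfin hC _)
        (by linarith) (by linarith) ?_
      filter_upwards [h] with p hp hpA hpB
      exact ⟨hp hpA.1 hpB.1, add_lt_add (mem_Ioi.1 hpA.2) (mem_Ioi.1 hpB.2)⟩
    linarith
  obtain ⟨y, hy0, hy1, hyd⟩ : ∃ y, 0 < massBelow B y ∧ massBelow B y < volume.real B ∧
      HasDerivAt (massBelow B) 1 y := by
    obtain ⟨y₁, h1⟩ := exists_massBelow_eq hB (m := volume.real B / 3) (by linarith) (by linarith)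
    obtain ⟨y₂, h2⟩ := exists_massBelow_eq hB (m := 2 * volume.real B / 3) (by linarith)
      (by linarith)
    have h12 : y₁ ≤ y₂ := by
      by_contra hlt
      have := massBelow_mono hB (not_le.1 hlt).le
      linarith
    have hpos : volume (B ∩ Ioc y₁ y₂) ≠ 0 := by
      intro h0
      have := massBelow_sub hB h12
      rw [Measure.real, h0, ENNReal.toReal_zero] at this
      linarith
    by_contra hcon
    push Not at hcon
    refine hpos (measure_mono_null (fun y hy => ?_) (ae_iff.1 (ae_hasDerivAt_massBelow hB hBm)))
    intro hd
    have h3 := massBelow_mono hB hy.2.1.le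
    have h4 := massBelow_mono hB hy.2.2
    exact hcon y (by linarith) (by linarith) (hd hy.1)
  -- Writing `z + y` also as `x + (z + (y - x))`, additivity shows that near `x` the distribution
  -- function of `A` is a translate of that of `B` near `y`, up to a constant. One point `y` of
  -- slope `1` thus gives slope `1` at every `x`.
  refine ae_eq_Icc_of_hasDerivAt_massBelow hA hAm he hAe fun x hx hx' => ?_
  have hshift : HasDerivAt (fun z => massBelow B (z + (y - x)) + (massBelow A x - massBelow B y))
      1 x := by
    have h1 : HasDerivAt (massBelow B) 1 (x + (y - x)) := by simpa using hyd
    exact (h1.comp_add_const x (y - x)).add_const _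
  refine hshift.congr_of_eventuallyEq ?_
  have hcA := (massBelow_continuous hA).tendsto x
  have hcB : Filter.Tendsto (fun z => massBelow B (z + (y - x))) (nhds x) (nhds (massBelow B y)) := by
    have : Continuous fun z => massBelow B (z + (y - x)) :=
      (massBelow_continuous hB).comp (by fun_prop)
    simpa using this.tendsto x
  filter_upwards [hcA.eventually (lt_mem_nhds hx), hcA.eventually (gt_mem_nhds hx'),
    hcB.eventually (lt_mem_nhds hy0), hcB.eventually (gt_mem_nhds hy1)] with z a1 a2 a3 a4
  have e1 := hsum z y a1 a2 hy0 hy1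
  have e2 := hsum x (z + (y - x)) hx hx' a3 a4
  rw [show x + (z + (y - x)) = z + y by ring] at e2
  linarith

theorem massBelow_Icc (p q x : ℝ) : massBelow (Icc p q) x = max (min q x - p) 0 := by
  have : Icc p q ∩ Iic x = Icc p (min q x) := by
    ext z; simp only [mem_inter_iff, mem_Icc, mem_Iic, le_min_iff]; tauto
  rw [massBelow, this, Real.volume_real_Icc]

theorem center_eq_of_ae_eq_Icc {a b r : ℝ} (hr : 0 < r)
    (h : Icc (a - r) (a + r) =ᵐ[volume] Icc (b - r) (b + r)) : a = b := by
  have := massBelow_congr h a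
  rw [massBelow_Icc, massBelow_Icc] at this
  grind

/-- Symmetric truncation of an interval preserves its center. -/
theorem ae_eq_Icc_of_truncation {A : Set ℝ} {c c' e m l h : ℝ} (hm : 0 < m) (hme : m < e)
    (hA : A =ᵐ[volume] Icc (c - e) (c + e)) (hl : massBelow A l = m)
    (hh : massBelow A h = volume.real A - m)
    (ht : (A ∩ Icc l h : Set ℝ) =ᵐ[volume] Icc (c' - (e - m)) (c' + (e - m))) :
    A =ᵐ[volume] Icc (c' - e) (c' + e) := by
  have hAr : volume.real A = 2 * e := by
    rw [measureReal_congr hA, Real.volume_real_Icc_of_le (by linarith)]; ring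
  rw [massBelow_congr hA, massBelow_Icc] at hl hh
  rw [hAr] at hh
  -- The prescribed masses lie strictly between `0` and `2 * e`, where the distribution function of
  -- the interval is strictly increasing, so they determine both cuts.
  have hl' : l = c - (e - m) := by grind
  have hh' : h = c + (e - m) := by grind
  have h1 : (A ∩ Icc l h : Set ℝ) =ᵐ[volume] (Icc (c - e) (c + e) ∩ Icc l h : Set ℝ) :=
    hA.inter (Filter.EventuallyEq.refl _ _)
  have h2 : Icc (c - e) (c + e) ∩ Icc l h = Icc (c - (e - m)) (c + (e - m)) := by
    rw [hl', hh', Icc_inter_Icc, sup_eq_right.2 (by linarith), inf_eq_right.2 (by linarith)]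
  rw [h2] at h1
  rw [← center_eq_of_ae_eq_Icc (by linarith) (h1.symm.trans ht)]
  exact hA

/-! ### Recovering intervals from an inclusion of cells -/

section
variable {ι : Type*} {L : ι → (Fin 2 → ℝ) →ₗ[ℝ] ℝ} {s : Finset ι} {E : ι → Set ℝ} {e : ι → ℝ}

theorem PairwiseCoordinates.quasiMeasurePreserving (hL : PairwiseCoordinates L) {i j : ι}
    (hij : i ≠ j) : Measure.QuasiMeasurePreserving (L i) := by
  obtain ⟨C, -, -, hC⟩ := hL.exists_volume_pair hij
  have hm := (continuous_linearForm (L i)).measurable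
  refine ⟨hm, Measure.AbsolutelyContinuous.mk fun N hN h0 => ?_⟩
  rw [Measure.map_apply hm hN]
  have := hC N univ hN MeasurableSet.univ
  rw [h0, zero_mul, mul_zero] at this
  simp only [mem_univ, and_true] at this
  exact this

/-- If the intervals `E j`, `j ≠ k`, are centered at `L j z` and `L k x ∈ E k` for almost all `x`
in their cell, then `E k` is the interval centered at `L k z`. -/
theorem PairwiseCoordinates.ae_eq_Icc_of_forall_ne (hL : PairwiseCoordinates L) {i k : ι}
    (hik : i ≠ k) (t : Finset ι) (he : ∀ j ∈ t, 0 < e j) (hek : 0 < e k)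
    (hEk : volume (E k) = ENNReal.ofReal (2 * e k))
    {y : Fin 2 → ℝ} (hy : y ∈ poly L t e) (hyk : L k y = e k) {z : Fin 2 → ℝ}
    (hz : ∀ j ∈ t, E j =ᵐ[volume] Icc (L j z - e j) (L j z + e j))
    (hq : ∀ j ∈ t, Measure.QuasiMeasurePreserving (L j))
    (hae : ∀ᵐ x, x ∈ cells L t E → L k x ∈ E k) :
    E k =ᵐ[volume] Icc (L k z - e k) (L k z + e k) := by
  obtain ⟨v, u, C, hiv, hkv, hiu, hku, hvu, -, -, hΦ, -⟩ := exists_dual_slicing _ _ (hL i k hik)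
  have h1 : ∀ᵐ x, (∀ j ∈ t, L j x ∈ Ioo (L j z - e j) (L j z + e j)) → L k x ∈ E k := by
    have h2 : ∀ᵐ x, ∀ j ∈ t, L j x ∈ Icc (L j z - e j) (L j z + e j) → L j x ∈ E j := by
      refine (Filter.eventually_all_finset t).2 fun j hj => (hq j hj).ae
        (p := fun τ => τ ∈ Icc (L j z - e j) (L j z + e j) → τ ∈ E j) ?_
      filter_upwards [hz j hj] with x hx hx'
      exact hx.mpr hx'
    filter_upwards [h2, hae] with x hx hx' hI
    exact hx' fun j hj => hx j hj (Ioo_subset_Icc_self (hI j hj))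
  have h2 : ∀ᵐ p : ℝ × ℝ, (∀ j ∈ t, L j (p.2 • v + p.1 • u) ∈ Ioo (L j z - e j) (L j z + e j)) →
      L k (p.2 • v + p.1 • u) ∈ E k :=
    (Measure.measurePreserving_swap (μ := volume) (ν := volume)).quasiMeasurePreserving.ae
      (hΦ.ae h1)
  have h3 : ∀ᵐ τ : ℝ, τ ∈ Ioo (L k z - e k) (L k z + e k) → τ ∈ E k := by
    filter_upwards [Measure.ae_ae_of_ae_prod (μ := volume) (ν := volume) h2] with τ hτ hτI
    -- Moving from `z` in the direction of the touching point reaches height `L k x = τ` while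
    -- staying strictly inside the other strips. The slice at height `τ` is therefore open and
    -- nonempty, so of positive measure, and for almost every `τ` it forces `τ ∈ E k`.
    set x := z + ((τ - L k z) / e k) • y with hx
    have hxk : L k x = τ := by simp [hx, hyk, hek.ne']
    have hc : |(τ - L k z) / e k| < 1 := by
      rw [abs_div, abs_of_pos hek, div_lt_one hek, abs_lt]
      constructor <;> linarith [hτI.1, hτI.2]
    have hopen : IsOpen {r : ℝ | ∀ j ∈ t, L j (r • v + τ • u) ∈ Ioo (L j z - e j) (L j z + e j)} := by
      have : {r : ℝ | ∀ j ∈ t, L j (r • v + τ • u) ∈ Ioo (L j z - e j) (L j z + e j)} =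
          ⋂ j ∈ t, (fun r : ℝ => L j (r • v + τ • u)) ⁻¹' Ioo (L j z - e j) (L j z + e j) := by
        ext; simp
      rw [this]
      exact isOpen_biInter_finset fun j _ =>
        isOpen_Ioo.preimage ((continuous_linearForm (L j)).comp (by fun_prop))
    have hmem : L i x ∈ {r : ℝ | ∀ j ∈ t, L j (r • v + τ • u) ∈ Ioo (L j z - e j) (L j z + e j)} := by
      intro j hj
      have hvux := hvu x
      rw [hxk] at hvux
      rw [← hvux, hx, map_add, map_smul, smul_eq_mul]
      have h4 : |(τ - L k z) / e k * L j y| < e j := by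
        rw [abs_mul]
        calc _ ≤ |(τ - L k z) / e k| * e j := by
              gcongr; exact mem_poly.1 hy j hj
          _ < e j := mul_lt_of_lt_one_left (he j hj) hc
      rw [abs_lt] at h4
      constructor <;> linarith [h4.1, h4.2]
    have hpos := hopen.measure_pos volume ⟨_, hmem⟩
    by_contra hcon
    refine hpos.ne' (measure_mono_null (fun r hr => ?_) (ae_iff.1 hτ))
    intro hr'
    have := hr' hr
    simp only [map_add, map_smul, hkv, hku, smul_eq_mul, mul_zero, mul_one, zero_add] at this
    exact hcon this
  have h4 : Ioo (L k z - e k) (L k z + e k) =ᵐ[volume] E k := by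
    refine ae_eq_of_ae_subset_of_measure_ge h3 ?_ measurableSet_Ioo.nullMeasurableSet ?_
    · rw [hEk, Real.volume_Ioo]
      exact ENNReal.ofReal_le_ofReal (by linarith)
    · rw [hEk]; exact ENNReal.ofReal_ne_top
  exact h4.symm.trans Ioo_ae_eq_Icc

/-- The case of two strips and a third one that touches their intersection. -/
theorem PairwiseCoordinates.exists_ae_eq_Icc_of_pair (hL : PairwiseCoordinates L) {i j k : ι}
    (hij : i ≠ j) (hik : i ≠ k) (hjk : j ≠ k) (hEi : MeasurableSet (E i))
    (hEj : MeasurableSet (E j)) (hei : 0 < e i) (hej : 0 < e j) (hek : 0 < e k)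
    (hvi : volume (E i) = ENNReal.ofReal (2 * e i)) (hvj : volume (E j) = ENNReal.ofReal (2 * e j))
    (hvk : volume (E k) = ENNReal.ofReal (2 * e k)) {y : Fin 2 → ℝ} (hyi : |L i y| ≤ e i)
    (hyj : |L j y| ≤ e j) (hyk : L k y = e k)
    (hae : ∀ᵐ x, L i x ∈ E i → L j x ∈ E j → L k x ∈ E k) :
    ∃ c, E i =ᵐ[volume] Icc (c - e i) (c + e i) := by
  obtain ⟨v, u, C, hiv, hjv, hiu, hju, hvu, -, -, hΦ, -⟩ := exists_dual_slicing _ _ (hL i j hij)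
  set α := L k v with hα
  set β := L k u with hβ
  have hα0 : α ≠ 0 := by
    intro h
    have : v = 0 := hL.eq_zero hjk hjv h
    simp [this] at hiv
  have hβ0 : β ≠ 0 := by
    intro h
    have : u = 0 := hL.eq_zero hik hiu h
    simp [this] at hju
  have hscale : ∀ {a : ℝ} {S : Set ℝ} {w : ℝ}, a ≠ 0 → 0 < w → volume S = ENNReal.ofReal (2 * w) →
      volume {r : ℝ | r * a⁻¹ ∈ S} = ENNReal.ofReal (2 * (|a| * w)) := by
    intro a S w ha hw hS
    have := volume_affine_preimage (inv_ne_zero ha) 0 S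
    simp only [add_zero, inv_inv] at this
    rw [this, hS, ← ENNReal.ofReal_mul (abs_nonneg _)]
    congr 1; ring
  have hA := hscale hα0 hei hvi
  have hB := hscale hβ0 hej hvj
  have hαe : 0 < |α| * e i := mul_pos (abs_pos.2 hα0) hei
  have hβe : 0 < |β| * e j := mul_pos (abs_pos.2 hβ0) hej
  have hreal : ∀ {S : Set ℝ} {w : ℝ}, 0 < w → volume S = ENNReal.ofReal (2 * w) →
      volume.real S = 2 * w := by
    intro S w hw hS
    rw [Measure.real, hS, ENNReal.toReal_ofReal (by linarith)]
  -- In coordinates `L k = α * L i + β * L j`, so the hypothesis says that the sumset of the dilates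
  -- `α E i` and `β E j` lies in `E k`, up to null sets.
  have hsum : ∀ᵐ p : ℝ × ℝ, p.1 ∈ {r : ℝ | r * α⁻¹ ∈ E i} → p.2 ∈ {r : ℝ | r * β⁻¹ ∈ E j} →
      p.1 + p.2 ∈ E k := by
    have hmul : ∀ {a : ℝ}, a ≠ 0 → Measure.QuasiMeasurePreserving (fun r : ℝ => r * a⁻¹) := by
      intro a ha
      refine ⟨by fun_prop, ?_⟩
      rw [Real.map_volume_mul_right (inv_ne_zero ha)]
      exact Measure.smul_absolutelyContinuous
    have h2 := (QuasiMeasurePreserving.prodMap (hmul hα0) (hmul hβ0)).ae (hΦ.ae hae)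
    filter_upwards [h2] with p hp h1 h2
    have := hp (by simpa [hiv, hiu] using h1) (by simpa [hjv, hju] using h2)
    simp only [Prod.map_fst, Prod.map_snd, map_add, map_smul, smul_eq_mul, ← hα, ← hβ] at this
    rwa [inv_mul_cancel_right₀ hα0, inv_mul_cancel_right₀ hβ0] at this
  -- The touching point gives `e k ≤ |α| * e i + |β| * e j`, which is the equality case of
  -- Brunn–Minkowski.
  have hle : volume.real (E k) ≤
      volume.real {r : ℝ | r * α⁻¹ ∈ E i} + volume.real {r : ℝ | r * β⁻¹ ∈ E j} := by
    rw [hreal hek hvk, hreal hαe hA, hreal hβe hB, ← hyk]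
    have h1 : L k y = L i y * α + L j y * β := by
      conv_lhs => rw [hvu y]
      simp [hα, hβ]
    have h2 : L i y * α ≤ |α| * e i := by
      rw [mul_comm |α|]
      exact (le_abs_self _).trans (by rw [abs_mul]; gcongr)
    have h3 : L j y * β ≤ |β| * e j := by
      rw [mul_comm |β|]
      exact (le_abs_self _).trans (by rw [abs_mul]; gcongr)
    linarith
  have hmeas : ∀ {a : ℝ} {S : Set ℝ}, MeasurableSet S → MeasurableSet {r : ℝ | r * a⁻¹ ∈ S} :=
    fun hS => (measurable_id.mul_const _) hS
  obtain ⟨c, hc⟩ := ae_eq_Icc_of_ae_add_mem (A := {r : ℝ | r * α⁻¹ ∈ E i})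
    (B := {r : ℝ | r * β⁻¹ ∈ E j}) (C := E k)
    (by rw [hA]; exact ENNReal.ofReal_ne_top) (by rw [hB]; exact ENNReal.ofReal_ne_top)
    (by rw [hvk]; exact ENNReal.ofReal_ne_top) (hmeas hEi) (hmeas hEj) hαe (hreal hαe hA)
    (by rw [hreal hβe hB]; linarith) hsum hle
  refine ⟨c / α, ?_⟩
  have hq : Measure.QuasiMeasurePreserving (fun r : ℝ => r * α) := by
    refine ⟨by fun_prop, ?_⟩
    rw [Real.map_volume_mul_right hα0]
    exact Measure.smul_absolutelyContinuous
  have h1 := hq.preimage_ae_eq hc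
  have e1 : (fun r : ℝ => r * α) ⁻¹' {r : ℝ | r * α⁻¹ ∈ E i} = E i := by
    ext r; simp [hα0]
  have e2 : (fun r : ℝ => r * α) ⁻¹' Icc (c - |α| * e i) (c + |α| * e i) =
      Icc (c / α - e i) (c / α + e i) := by
    ext r
    have h3 : r - c / α = (r * α - c) / α := by field_simp
    have h4 : |r - c / α| ≤ e i ↔ |r * α - c| ≤ |α| * e i := by
      rw [h3, abs_div, div_le_iff₀ (abs_pos.2 hα0), mul_comm (e i)]
    rw [abs_le, abs_le] at h4
    simp only [mem_preimage, mem_Icc]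
    constructor
    · rintro ⟨a, b⟩
      have := h4.2 ⟨by linarith, by linarith⟩
      exact ⟨by linarith [this.1], by linarith [this.2]⟩
    · rintro ⟨a, b⟩
      have := h4.1 ⟨by linarith, by linarith⟩
      exact ⟨by linarith [this.1], by linarith [this.2]⟩
  rwa [e1, e2] at h1

end

/-! ### Cases of equality -/

section
variable {ι : Type*} {L : ι → (Fin 2 → ℝ) →ₗ[ℝ] ℝ} {s : Finset ι} {E : ι → Set ℝ} {e : ι → ℝ}
variable [DecidableEq ι]

/-- Cases of equality in the rearrangement inequality when all strips touch the polygon. -/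
theorem PairwiseCoordinates.exists_center_of_volume_eq (hL : PairwiseCoordinates L)
    (hs : 3 ≤ s.card) (hE : ∀ j ∈ s, MeasurableSet (E j)) (he : ∀ j ∈ s, 0 < e j)
    (hEe : ∀ j ∈ s, volume (E j) = ENNReal.ofReal (2 * e j)) (ht : Touching L s e)
    (heq : volume (cells L s E) = volume (poly L s e)) :
    ∃ z, ∀ j ∈ s, E j =ᵐ[volume] Icc (L j z - e j) (L j z + e j) := by
  obtain ⟨N, hN⟩ : ∃ N, s.card = N + 3 := ⟨s.card - 3, by omega⟩
  induction N using Nat.strong_induction_on generalizing s E e with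
  | _ N ih =>
  have hborder : ∀ (E : ι → Set ℝ) (e : ι → ℝ), (∀ j ∈ s, MeasurableSet (E j)) →
      (∀ j ∈ s, 0 < e j) → (∀ j ∈ s, volume (E j) = ENNReal.ofReal (2 * e j)) →
      Touching L s e → (∃ k ∈ s, Redundant L s e k) →
      volume (cells L s E) = volume (poly L s e) →
      ∃ z, ∀ j ∈ s, E j =ᵐ[volume] Icc (L j z - e j) (L j z + e j) := by
    rintro E e hE he hEe ht ⟨k, hk, hR⟩ heq
    have hcard : (s.erase k).card = N + 2 := by rw [Finset.card_erase_of_mem hk]; omega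
    have hmem : ∀ {j}, j ∈ s.erase k → j ∈ s := fun hj => Finset.mem_of_mem_erase hj
    have hsub : cells L s E ⊆ cells L (s.erase k) E := cells_anti (Finset.erase_subset _ _) _
    have hle : volume (cells L (s.erase k) E) ≤ volume (poly L (s.erase k) e) :=
      hL.volume_cells_le (by omega) (fun j hj => hE j (hmem hj)) (fun j hj => he j (hmem hj))
        (fun j hj => hEe j (hmem hj))
    -- Removing `k` enlarges the cell but not the polygon, so the rearrangement inequality for the
    -- remaining strips squeezes all the volumes together.
    have heq' : volume (cells L (s.erase k) E) = volume (poly L (s.erase k) e) := by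
      refine le_antisymm hle ?_
      rw [hR.poly_erase, ← heq]
      exact measure_mono hsub
    have hfull : cells L s E =ᵐ[volume] cells L (s.erase k) E := by
      refine ae_eq_of_subset_of_measure_ge hsub ?_ (measurableSet_cells hE).nullMeasurableSet ?_
      · rw [heq', heq, hR.poly_erase]
      · rw [heq']; exact hL.volume_poly_ne_top (by omega)
    have hae : ∀ᵐ x, x ∈ cells L (s.erase k) E → L k x ∈ E k := by
      filter_upwards [hfull] with x hx hx'
      exact (hx.mpr hx' : x ∈ cells L s E) k hk
    obtain ⟨y, hy, hyk⟩ := ht k hk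
    have hother : ∃ z, ∀ j ∈ s.erase k, E j =ᵐ[volume] Icc (L j z - e j) (L j z + e j) := by
      rcases Nat.eq_zero_or_pos N with rfl | hNpos
      · obtain ⟨i, j, hij, hset⟩ := Finset.card_eq_two.1 hcard
        have hi : i ∈ s.erase k := by rw [hset]; simp
        have hj : j ∈ s.erase k := by rw [hset]; simp
        have hik := Finset.ne_of_mem_erase hi
        have hjk := Finset.ne_of_mem_erase hj
        have hae' : ∀ᵐ x, L i x ∈ E i → L j x ∈ E j → L k x ∈ E k := by
          filter_upwards [hae] with x hx h1 h2
          refine hx ?_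
          rw [hset]
          simp [cells, h1, h2]
        have hyi := mem_poly.1 hy i (hmem hi)
        have hyj := mem_poly.1 hy j (hmem hj)
        obtain ⟨a, ha⟩ := hL.exists_ae_eq_Icc_of_pair hij hik hjk (hE i (hmem hi)) (hE j (hmem hj))
          (he i (hmem hi)) (he j (hmem hj)) (he k hk) (hEe i (hmem hi)) (hEe j (hmem hj))
          (hEe k hk) hyi hyj hyk hae'
        obtain ⟨b, hb⟩ := hL.exists_ae_eq_Icc_of_pair hij.symm hjk hik (hE j (hmem hj))
          (hE i (hmem hi)) (he j (hmem hj)) (he i (hmem hi)) (he k hk) (hEe j (hmem hj))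
          (hEe i (hmem hi)) (hEe k hk) hyj hyi hyk
          (by filter_upwards [hae'] with x hx h1 h2 using hx h2 h1)
        obtain ⟨z, hz⟩ := (hL i j hij).2 (a, b)
        simp only [Prod.mk.injEq] at hz
        refine ⟨z, ?_⟩
        rw [hset]
        simp only [Finset.mem_insert, Finset.mem_singleton, forall_eq_or_imp, forall_eq, hz.1, hz.2]
        exact ⟨ha, hb⟩
      · have ht' : Touching L (s.erase k) e := by
          intro l hl
          obtain ⟨x, hx, hxl⟩ := ht l (hmem hl)
          exact ⟨x, cells_anti (Finset.erase_subset _ _) _ hx, hxl⟩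
        exact ih (N - 1) (by omega) (by omega) (fun j hj => hE j (hmem hj))
          (fun j hj => he j (hmem hj)) (fun j hj => hEe j (hmem hj)) ht' heq' (by omega)
    obtain ⟨z, hz⟩ := hother
    refine ⟨z, fun j hj => ?_⟩
    by_cases hjk : j = k
    · subst hjk
      obtain ⟨i, hi⟩ : (s.erase j).Nonempty := Finset.card_pos.1 (by omega)
      exact hL.ae_eq_Icc_of_forall_ne (Finset.ne_of_mem_erase hi) (s.erase j)
        (fun l hl => he l (hmem hl)) (he j hj) (hEe j hj)
        (cells_anti (Finset.erase_subset _ _) _ hy) hyk hz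
        (fun l hl => hL.quasiMeasurePreserving (Finset.ne_of_mem_erase hl)) hae
    · exact hz j (Finset.mem_erase.2 ⟨hjk, hj⟩)
  by_cases hred : ∃ k ∈ s, Redundant L s e k
  · exact hborder E e hE he hEe ht hred heq
  push Not at hred
  have htrunc : ∀ n ∈ s, ∃ (E' : ι → Set ℝ) (e' : ι → ℝ) (z : Fin 2 → ℝ),
      E' n = E n ∧ e' n = e n ∧ (∀ j ∈ s, j ≠ n → ∃ l h m, E' j = E j ∩ Icc l h ∧ 0 < m ∧
        m < e j ∧ e' j = e j - m ∧ massBelow (E j) l = m ∧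
        massBelow (E j) h = volume.real (E j) - m) ∧
      ∀ j ∈ s, E' j =ᵐ[volume] Icc (L j z - e' j) (L j z + e' j) := by
    intro n hn
    obtain ⟨E', e', D, h1, h2, h3, h4, h5, h6, h7, h8, hD, h9, h10⟩ :=
      hL.exists_truncated hs hE he hEe hred hn
    -- The finite cost `D` enters both estimates and cancels, so equality passes to the truncated
    -- sets.
    have heq' : volume (cells L s E') = volume (poly L s e') := by
      refine le_antisymm (hL.volume_cells_le (by omega) h1 h2 h3) ?_
      refine (ENNReal.add_le_add_iff_right hD).1 ?_
      calc _ ≤ volume (poly L s e) := h10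
        _ = volume (cells L s E) := heq.symm
        _ ≤ _ := h9
    obtain ⟨z, hz⟩ := hborder E' e' h1 h2 h3 h4 h5 heq'
    exact ⟨E', e', z, h6, h7, h8, hz⟩
  have hinterval : ∀ n ∈ s, ∃ c, E n =ᵐ[volume] Icc (c - e n) (c + e n) := by
    intro n hn
    obtain ⟨E', e', z, h1, h2, -, hz⟩ := htrunc n hn
    have := hz n hn
    rw [h1, h2] at this
    exact ⟨_, this⟩
  obtain ⟨n, hn⟩ : s.Nonempty := Finset.card_pos.1 (by omega)
  obtain ⟨E', e', z, h1, h2, h3, hz⟩ := htrunc n hn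
  refine ⟨z, fun j hj => ?_⟩
  have hzj := hz j hj
  by_cases hjn : j = n
  · subst hjn
    rwa [h1, h2] at hzj
  · obtain ⟨l, h, m, h4, hm, hme, h5, hl, hh⟩ := h3 j hj hjn
    obtain ⟨c, hc⟩ := hinterval j hj
    rw [h4, h5] at hzj
    exact ae_eq_Icc_of_truncation hm hme hc hl hh hzj

end

/-! ### Passage to the integral form and the theorem -/

theorem Nondegenerate.pairwiseCoordinates {n : ℕ} {L : Fin n → ((Fin 2 → ℝ) →ₗ[ℝ] ℝ)}
    (hL : Nondegenerate L) : PairwiseCoordinates L := by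
  intro i j hij
  obtain ⟨hinj, hsurj⟩ := hL {i, j} (Finset.card_pair hij)
  refine ⟨fun x y hxy => hinj (funext ?_), ?_⟩
  · simp only [Prod.mk.injEq] at hxy
    rintro ⟨k, hk⟩
    rcases Finset.mem_insert.1 hk with rfl | hk
    · exact hxy.1
    · rw [Finset.mem_singleton] at hk
      subst hk
      exact hxy.2
  · rintro ⟨a, b⟩
    obtain ⟨x, hx⟩ := hsurj fun k => if k.1 = i then a else b
    have h1 := congrFun hx ⟨i, by simp⟩
    have h2 := congrFun hx ⟨j, by simp⟩
    simp only [if_true, if_neg hij.symm] at h1 h2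
    exact ⟨x, by simp [h1, h2]⟩

theorem multiForm_eq_volume_cells {n : ℕ} {L : Fin n → ((Fin 2 → ℝ) →ₗ[ℝ] ℝ)}
    {E : Fin n → Set ℝ} (hE : ∀ j, MeasurableSet (E j)) :
    multiForm L E = volume (cells L Finset.univ E) := by
  rw [multiForm, ← lintegral_indicator_one (measurableSet_cells fun j _ => hE j)]
  congr 1
  funext x
  by_cases hx : x ∈ cells L Finset.univ E
  · rw [indicator_of_mem hx]
    exact Finset.prod_eq_one fun j hj => indicator_of_mem (hx j hj) _
  · rw [indicator_of_notMem hx]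
    simp only [cells, mem_ofPred_eq] at hx
    push Not at hx
    obtain ⟨j, hj, hxj⟩ := hx
    exact Finset.prod_eq_zero hj (indicator_of_notMem hxj _)

theorem PairwiseCoordinates.multiForm_congr {n : ℕ} {L : Fin n → ((Fin 2 → ℝ) →ₗ[ℝ] ℝ)}
    (hL : PairwiseCoordinates L) (hn : 2 ≤ n) {E F : Fin n → Set ℝ}
    (h : ∀ j, E j =ᵐ[volume] F j) : multiForm L E = multiForm L F := by
  have := Fin.nontrivial_iff_two_le.2 hn
  have h1 : ∀ᵐ x, ∀ j, (L j x ∈ E j ↔ L j x ∈ F j) := by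
    refine ae_all_iff.2 fun j => ?_
    obtain ⟨i, hi⟩ := exists_ne j
    refine (hL.quasiMeasurePreserving hi.symm).ae (p := fun t => (t ∈ E j ↔ t ∈ F j)) ?_
    filter_upwards [h j] with t ht
    exact iff_of_eq ht
  refine lintegral_congr_ae ?_
  filter_upwards [h1] with x hx
  refine Finset.prod_congr rfl fun j _ => ?_
  by_cases hxj : L j x ∈ E j
  · rw [indicator_of_mem hxj, indicator_of_mem ((hx j).1 hxj)]
  · rw [indicator_of_notMem hxj, indicator_of_notMem fun hF => hxj ((hx j).2 hF)]

/-- If the strip `k` did not touch the polygon, the intersection of the others would lie in its open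
interior, which is just the neighborhood that admissibility forbids. -/
theorem Admissible.touching {n : ℕ} {L : Fin n → ((Fin 2 → ℝ) →ₗ[ℝ] ℝ)} {E : Fin n → Set ℝ}
    (hE : Admissible L E) : Touching L Finset.univ fun j => volume.real (E j) / 2 := by
  intro k _
  by_contra hcon
  refine hE.2 ⟨k, {x | |L k x| < volume.real (E k) / 2},
    isOpen_lt (continuous_linearForm (L k)).abs continuous_const, fun x hx => ?_, fun x hx => ?_⟩
  · by_contra hlt
    refine hcon (exists_mem_poly_eq ?_ (x := x) ?_ (not_lt.1 hlt))
    · exact half_pos (ENNReal.toReal_pos (hE.1 k).2.1.ne' (hE.1 k).2.2.ne)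
    · intro j hj
      exact mem_iInter₂.1 hx j (Finset.ne_of_mem_erase hj)
  · have hx' : |L k x| < volume.real (E k) / 2 := hx
    have := abs_lt.1 hx'
    exact ⟨this.1.le, this.2.le⟩

theorem isIntervalCenteredAt_Icc {c r : ℝ} (hr : 0 < r) :
    IsIntervalCenteredAt (Icc (c - r) (c + r)) c :=
  ⟨ordConnected_Icc, c - r, c + r, isGLB_Icc (by linarith), isLUB_Icc (by linarith), by ring⟩

theorem IsIntervalCenteredAt.ae_eq_Icc {J : Set ℝ} {c : ℝ} (hJ : IsIntervalCenteredAt J c) :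
    J =ᵐ[volume] Icc (c - volume.real J / 2) (c + volume.real J / 2) := by
  obtain ⟨hconn, a, b, ha, hb, rfl⟩ := hJ
  have hsub : J ⊆ Icc a b := fun x hx => ⟨ha.1 hx, hb.1 hx⟩
  have hsup : Ioo a b ⊆ J := by
    intro x hx
    obtain ⟨y, hy, hyx⟩ := (isGLB_lt_iff ha).1 hx.1
    obtain ⟨w, hw, hxw⟩ := (lt_isLUB_iff hb).1 hx.2
    exact hconn.out hy hw ⟨hyx.le, hxw.le⟩
  have hae : J =ᵐ[volume] Icc a b := by
    refine Filter.EventuallyLE.antisymm hsub.eventuallyLE ?_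
    exact (Ioo_ae_eq_Icc (μ := volume) (a := a) (b := b)).symm.le.trans hsup.eventuallyLE
  have hne : J.Nonempty := ha.nonempty
  have hab : a ≤ b := (ha.1 hne.some_mem).trans (hb.1 hne.some_mem)
  rwa [measureReal_congr hae, Real.volume_real_Icc_of_le hab,
    show (a + b) / 2 - (b - a) / 2 = a by ring, show (a + b) / 2 + (b - a) / 2 = b by ring]

theorem theorem1 (n : ℕ) (hn : 3 ≤ n)
    (L : Fin n → ((Fin 2 → ℝ) →ₗ[ℝ] ℝ))
    (hsurj : ∀ i, Function.Surjective (L i))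
    (hL : Nondegenerate L)
    (E : Fin n → Set ℝ) (hE : Admissible L E) :
    multiForm L E = multiForm L (fun i => symmInterval (E i)) ↔
      ∃ (z : Fin 2 → ℝ) (J : Fin n → Set ℝ), ∀ i,
        IsIntervalCenteredAt (J i) (L i z) ∧ volume (symmDiff (E i) (J i)) = 0 := by
  have hP := hL.pairwiseCoordinates
  set e : Fin n → ℝ := fun j => volume.real (E j) / 2 with he
  have he0 : ∀ j, 0 < e j := fun j =>
    half_pos (ENNReal.toReal_pos (hE.1 j).2.1.ne' (hE.1 j).2.2.ne)
  have hstar : multiForm L (fun i => symmInterval (E i)) = volume (poly L Finset.univ e) :=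
    multiForm_eq_volume_cells fun j => measurableSet_Icc
  rw [hstar]
  constructor
  · intro heq
    -- The sets are only Lebesgue measurable; measurable hulls replace them without changing the
    -- integral.
    have hA : ∀ j, toMeasurable volume (E j) =ᵐ[volume] E j := fun j =>
      (hE.1 j).1.toMeasurable_ae_eq
    rw [hP.multiForm_congr (by omega) fun j => (hA j).symm,
      multiForm_eq_volume_cells fun j => measurableSet_toMeasurable _ _] at heq
    obtain ⟨z, hz⟩ := hP.exists_center_of_volume_eq (by simpa using hn)
      (fun j _ => measurableSet_toMeasurable _ _) (fun j _ => he0 j)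
      (fun j _ => by
        rw [measure_toMeasurable, he, mul_div_cancel₀ _ two_ne_zero,
          ofReal_measureReal (hE.1 j).2.2.ne]) hE.touching heq
    refine ⟨z, fun j => Icc (L j z - e j) (L j z + e j), fun j =>
      ⟨isIntervalCenteredAt_Icc (he0 j), ?_⟩⟩
    exact measure_symmDiff_eq_zero_iff.2 ((hA j).symm.trans (hz j (Finset.mem_univ j)))
  · rintro ⟨z, J, hJ⟩
    have hEJ : ∀ j, E j =ᵐ[volume] Icc (L j z - e j) (L j z + e j) := by
      intro j
      have h1 : E j =ᵐ[volume] J j := measure_symmDiff_eq_zero_iff.1 (hJ j).2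
      have h2 := (hJ j).1.ae_eq_Icc
      rw [← measureReal_congr h1] at h2
      exact h1.trans h2
    -- Intervals centered at the `L j z` cut out the translate by `z` of the centered polygon.
    rw [hP.multiForm_congr (by omega) hEJ, multiForm_eq_volume_cells fun j => measurableSet_Icc,
      ← measure_preimage_add_right volume (-z) (poly L Finset.univ e)]
    congr 1
    ext x
    simp only [cells, poly, mem_ofPred_eq, mem_preimage, map_add, map_neg, mem_Icc]
    refine forall₂_congr fun j _ => ?_
    constructor <;> rintro ⟨a, b⟩ <;> constructor <;> linarith
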